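/- Let $\tau$ be in the upper half plane and let $\wp$ be the Weierstrass function with periods $(1,\tau)$. Put $\omega_0=0$, $\omega_1=\frac12$, $\omega_2=-\frac{\tau+1}{2}$, $\omega_3=\frac{\tau}{2}$. Let $l_0,l_1,l_2,l_3\in\mathbb Z_{\ge 0}$, not all zero, $u(x)=\sum_{i=0}^3 l_i(l_i+1)\wp(x+\omega_i)$ and $H=-\frac{d^2}{dx^2}+u(x)$. Let $$\Xi(x,E)=c_0(E)+\sum_{i=0}^3\sum_{j=0}^{l_i-1}b^{(i)}_j(E)\,\wp(x+\omega_i)^{l_i-j}$$ be the doubly periodic function, with polynomial coefficients $c_0$ (monic) and $b^{(i)}_j$ without common divisor, such that for every $E$ the function $h=\Xi(\cdot,E)$ solves $h'''-4(u-E)h'-2u'h=0$ (the equation satisfied by products of two solutions of $(H-E)f=0$). Put $g=\deg c_0$ and (with $'=d/dx$) $$Q(E)=\Xi^2(E-u)+\tfrac12\,\Xi\,\Xi''-\tfrac14(\Xi')^2 ;$$ this does not depend on $x$ and is a monic polynomial in $E$ of degree $2g+1$. For a value of $\sqrt{-Q(E)}$ let $$\Lambda(x,E)=\sqrt{\Xi(x,E)}\,\exp\int\frac{\sqrt{-Q(E)}}{\Xi(x,E)}\,dx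 ,$$ a meromorphic function of $x\in\mathbb C$, determined up to a non-zero constant factor. **Theorem.** Let $P\in\mathbb Z+\mathbb Z\tau$ and let $\varepsilon\in\mathbb C$ be such that the segment from $\varepsilon$ to $P+\varepsilon$ contains no pole of $u$. Let $E_0^{(P)},E_*\in\mathbb C$ be joined by a path in the $E$-plane, continuously differentiable in its interior and meeting zeros of $Q$ at most at its ends, with a continuous branch of $\sqrt{-Q(E)}$ along it; $\Lambda(x,E_0^{(P)})$ and $\Lambda(x,E_*)$ are formed with the values of this branch at the two ends. If $\Lambda(x+P,E_0^{(P)})=\Lambda(x,E_0^{(P)})$ (resp. $=-\Lambda(x,E_0^{(P)})$), then the integral over $E$ along the path below converges (as an improper integral if an end is a zero of $Q$), and $$\Lambda(x+P,E_*)=\Lambda(x,E_*)\exp\left(-\frac12\int_{E_0^{(P)}}^{E_*}\frac{\int_{\varepsilon}^{P+\varepsilon}\Xi(x,E)\,dx}{\sqrt{-Q(E)}}\,dE\right)$$ (resp. the same with $-\Lambda(x,E_*)$ on the right-hand side). In particular, $Q_1(E)=\int_{\varepsilon}^{1+\varepsilon}\Xi(x,E)\,dx$ is a polynomial in $E$ of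 degree $g$ that does not depend on the choice of $\varepsilon$ (with the segment from $\varepsilon$ to $1+\varepsilon$ free of poles of $u$), and if $\Lambda(x+1,E_0)=\Lambda(x,E_0)$ (resp. $=-\Lambda(x,E_0)$), then, for every path from $E_0$ to $E_*$ and branch as above, $$\Lambda(x+1,E_*)=\Lambda(x,E_*)\exp\left(-\frac12\int_{E_0}^{E_*}\frac{Q_1(E)}{\sqrt{-Q(E)}}\,dE\right)$$ (resp. the same with $-\Lambda(x,E_*)$ on the right-hand side). The integral in the exponent is a hyperelliptic integral of the second kind: the differential $Q_1(E)\,dE/\sqrt{-Q(E)}$ is, near every point (including infinity) of the normalized compactified curve $\nu^2=-Q(E)$, the differential of a meromorphic function. -/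

import Mathlib

open Polynomial Filter Topology

noncomputable section

namespace Inozemtsev

/-- The pair of basic periods `(1, τ)`. -/
def periods (τ : UpperHalfPlane) : PeriodPair where
  ω₁ := 1
  ω₂ := (τ : ℂ)
  indep := by
    rw [LinearIndependent.pair_iff]
    intro s t h
    have him := congrArg Complex.im h
    have hre := congrArg Complex.re h
    simp at him hre
    have ht : t = 0 := him.resolve_right (ne_of_gt τ.im_pos)
    subst ht
    simpa using hre

/-- The Weierstrass function `℘` with periods `(1, τ)`. -/
def wp (τ : UpperHalfPlane) (x : ℂ) : ℂ := (periods τ).weierstrassP x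

/-- The derivative `℘'` of the Weierstrass function with periods `(1, τ)`. -/
def wp' (τ : UpperHalfPlane) (x : ℂ) : ℂ := (periods τ).derivWeierstrassP x

/-- The half-periods `ω₀ = 0`, `ω₁ = 1/2`, `ω₂ = -(τ+1)/2`, `ω₃ = τ/2`. -/
def halfPeriod (τ : UpperHalfPlane) : Fin 4 → ℂ :=
  ![0, 1 / 2, -((τ : ℂ) + 1) / 2, (τ : ℂ) / 2]

/-- The potential `u(x) = ∑ᵢ lᵢ(lᵢ+1) ℘(x + ωᵢ)` of the Hamiltonian `H = -d²/dx² + u(x)`. -/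
def potential (τ : UpperHalfPlane) (l : Fin 4 → ℕ) (x : ℂ) : ℂ :=
  ∑ i, (l i : ℂ) * ((l i : ℂ) + 1) * wp τ (x + halfPeriod τ i)

/-- The derivative `u'(x) = ∑ᵢ lᵢ(lᵢ+1) ℘'(x + ωᵢ)` of the potential. -/
def potential' (τ : UpperHalfPlane) (l : Fin 4 → ℕ) (x : ℂ) : ℂ :=
  ∑ i, (l i : ℂ) * ((l i : ℂ) + 1) * wp' τ (x + halfPeriod τ i)

/-- The poles of the potential: the points congruent to some `-ωᵢ` with `lᵢ ≠ 0`. -/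
def poles (τ : UpperHalfPlane) (l : Fin 4 → ℕ) : Set ℂ :=
  {x | ∃ i, l i ≠ 0 ∧ x + halfPeriod τ i ∈ (periods τ).lattice}

/-- The expression
`Ξ(x,E) = c₀(E) + ∑_{i=0}^3 ∑_{j=0}^{lᵢ-1} b^{(i)}_j(E) ℘(x+ωᵢ)^{lᵢ-j}`
with given coefficient polynomials. -/
def Xi (τ : UpperHalfPlane) (l : Fin 4 → ℕ) (c₀ : ℂ[X]) (b : (i : Fin 4) → Fin (l i) → ℂ[X])
    (x E : ℂ) : ℂ :=
  c₀.eval E + ∑ i, ∑ j : Fin (l i), (b i j).eval E * wp τ (x + halfPeriod τ i) ^ (l i - (j : ℕ))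

/-- The polynomials `c₀`, `b^{(i)}_j` are the coefficients of the doubly periodic function `Ξ`:
`c₀` is monic, they have no common divisor, and for each `E` the function `Ξ(·,E)` satisfies
the third order equation `h''' - 4 (u - E) h' - 2 u' h = 0` of products of two solutions of
`(H - E) f = 0`. -/
structure IsXiCoeff (τ : UpperHalfPlane) (l : Fin 4 → ℕ) (c₀ : ℂ[X])
    (b : (i : Fin 4) → Fin (l i) → ℂ[X]) : Prop where
  monic : c₀.Monic
  coprime : ∀ d : ℂ[X], d ∣ c₀ → (∀ i j, d ∣ b i j) → IsUnit d
  ode : ∀ E : ℂ, ∀ x ∉ poles τ l,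
    iteratedDeriv 3 (fun y => Xi τ l c₀ b y E) x
      - 4 * (potential τ l x - E) * deriv (fun y => Xi τ l c₀ b y E) x
      - 2 * potential' τ l x * Xi τ l c₀ b x E = 0

/-- `Ξ² (E - u) + ½ Ξ Ξ'' - ¼ (Ξ')²`, where `'` is `d/dx`. -/
def firstIntegral (τ : UpperHalfPlane) (l : Fin 4 → ℕ) (c₀ : ℂ[X])
    (b : (i : Fin 4) → Fin (l i) → ℂ[X]) (x E : ℂ) : ℂ :=
  Xi τ l c₀ b x E ^ 2 * (E - potential τ l x)
    + 1 / 2 * Xi τ l c₀ b x E * iteratedDeriv 2 (fun y => Xi τ l c₀ b y E) x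
    - 1 / 4 * deriv (fun y => Xi τ l c₀ b y E) x ^ 2

/-- `Λ` is (a branch-free version of) the function `√Ξ(x,E) · exp ∫ s dx / Ξ(x,E)`, where `s` is a
chosen value of `√(-Q(E))`: it is a meromorphic function on `ℂ` (normalized to have the value `0`
at its poles) which, near each point where `Ξ(·,E)` is regular and non-zero, is the product of a
branch `r` of `√Ξ(·,E)` and of `exp I`, `I` being a primitive of `s / Ξ(·,E)`. Since the constant
of integration is arbitrary, `Λ` is determined up to a non-zero constant factor. -/
structure IsLambda (τ : UpperHalfPlane) (l : Fin 4 → ℕ) (c₀ : ℂ[X])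
    (b : (i : Fin 4) → Fin (l i) → ℂ[X]) (E s : ℂ) (Λ : ℂ → ℂ) : Prop where
  meromorphic : MeromorphicNFOn Λ Set.univ
  formula : ∀ x ∉ poles τ l, Xi τ l c₀ b x E ≠ 0 →
    ∃ r I : ℂ → ℂ, AnalyticAt ℂ r x ∧ ∀ᶠ y in 𝓝 x,
      r y ^ 2 = Xi τ l c₀ b y E ∧
      HasDerivAt I (s / Xi τ l c₀ b y E) y ∧
      Λ y = r y * Complex.exp (I y)

/-- The straight segment from `ε` to `P + ε` contains no pole. -/
def SegmentAvoids (τ : UpperHalfPlane) (l : Fin 4 → ℕ) (P ε : ℂ) : Prop :=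
  ∀ t ∈ Set.Icc (0 : ℝ) 1, ε + (t : ℂ) * P ∉ poles τ l

/-- The integral `∫_{0+ε}^{P+ε} Ξ(x,E) dx` along the straight segment. -/
def periodIntegral (τ : UpperHalfPlane) (l : Fin 4 → ℕ) (c₀ : ℂ[X])
    (b : (i : Fin 4) → Fin (l i) → ℂ[X]) (P ε E : ℂ) : ℂ :=
  ∫ t in (0 : ℝ)..1, Xi τ l c₀ b (ε + (t : ℂ) * P) E * P

/-- A path `(γ, s)` on the curve `s² = -Q(E)` from `(E₀, s₀)` to `(E₁, s₁)`, i.e. a path `γ` in the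
`E`-plane together with a continuous branch `s` of `√(-Q)` along it: continuous on `[0,1]`, with
`γ` continuously differentiable on `(0,1)` and meeting zeros of `Q` at most at its ends. -/
structure IsBranchPath (Q : ℂ[X]) (E₀ s₀ E₁ s₁ : ℂ) (γ s : ℝ → ℂ) : Prop where
  continuousOn : ContinuousOn γ (Set.Icc 0 1)
  contDiffOn : ContDiffOn ℝ 1 γ (Set.Ioo 0 1)
  continuousOn_root : ContinuousOn s (Set.Icc 0 1)
  sq_root : ∀ t ∈ Set.Icc (0 : ℝ) 1, s t ^ 2 = -Q.eval (γ t)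
  ne_zero : ∀ t ∈ Set.Ioo (0 : ℝ) 1, Q.eval (γ t) ≠ 0
  source : γ 0 = E₀ ∧ s 0 = s₀
  target : γ 1 = E₁ ∧ s 1 = s₁

/-- The integral `∫ f(E) dE / √(-Q(E))` along a path `(γ, s)` converges and has the value `J`.
It is improper when an end of the path is a zero of `Q`. -/
def HasPathIntegral (f : ℂ → ℂ) (γ s : ℝ → ℂ) (J : ℂ) : Prop :=
  Tendsto (fun p : ℝ × ℝ => ∫ t in p.1..p.2, f (γ t) / s t * deriv γ t)
    (𝓝[>] (0 : ℝ) ×ˢ 𝓝[<] (1 : ℝ)) (𝓝 J)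

/-- The differential `N(E) dE / √(-Q(E))` on the (normalized, compactified) curve `ν² = -Q(E)` is of
the second kind: near each point of the curve, points at infinity included, it is the
differential of a meromorphic function (equivalently, it has no residues). The points are
reached by the meromorphic parametrizations `t ↦ (e(t), ν(t))` near `t = 0`. -/
def IsSecondKind (Q N : ℂ[X]) : Prop :=
  ∀ e ν : ℂ → ℂ, MeromorphicAt e 0 → MeromorphicAt ν 0 →
    (∀ᶠ t in 𝓝[≠] (0 : ℂ), ν t ^ 2 = -Q.eval (e t)) →
    ∃ F : ℂ → ℂ, MeromorphicAt F 0 ∧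
      ∀ᶠ t in 𝓝[≠] (0 : ℂ), HasDerivAt F (N.eval (e t) / ν t * deriv e t) t

end Inozemtsev

end

noncomputable section

namespace Inozemtsev

open Set intervalIntegral

/-! ### Linear differential equations -/

section LinearODE

/-! Fix `E`. The operator `f ↦ Ξ f' - Ξ' f / 2` acts on the solutions of `f'' = (u - E) f`. On
Cauchy data `(f, f')` it is a traceless matrix `B(x)`; the third order equation for `Ξ` is
equivalent to the Lax equation `B' = [A, B]` for the coefficient matrix `A` of the first order
system, and the first integral gives `B² = -Q`. The function `Λ` is a solution lying in the
eigenspace of `B` with eigenvalue `√(-Q)`.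

Let `T` be the transfer matrix from `ε` to `ε + P`. Since `B` is periodic, `T` commutes with `B(ε)`.
That matrix is never zero, because otherwise `Ξ(·,E)` would vanish identically, which the absence of
a common divisor forbids. Hence `T = α + β B(ε)`, and `Λ` is multiplied by `μ = α + β ν` along `P`,
where `ν = √(-Q)`. This is `exists_monodromy`.

Differentiating `T` in `E` by variation of constants and taking the traces of `T'` and of `T' B`
gives `α' = -β I / 2` and `2 Q β' + Q' β = α I`, where `I = ∫ Ξ dx`. Together they say `dμ / μ = -(I
/ 2ν) dE` on the curve `ν² = -Q`. Since `det T = α² + β² Q` is nonzero, `μ` has no zeros, not even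
at branch points. So `log μ` stays continuous up to the ends of a path, which yields both the
convergence of the integral and the formula.

For the period `1`, the function `-2 log μ` is also a local primitive of `Q₁ dE / ν` at every finite
point of the curve. At infinity the degrees `2g + 1` and `g` make the differential `κ(z²) dz / z²`
with `z² = 1 / E`. It is even in `z`, so there is no residue. The degrees rest on `coeff_eq_zero`
(every `b` has degree below `g`), which compares powers of `E` in the third order equation. -/

/-- The successive terms of the Picard (Dyson) series of the equation `y' = L(t) y`. -/
def dysonTerm {F : Type*} [NormedAddCommGroup F] [NormedSpace ℝ F]
    (L : ℝ → F →L[ℝ] F) (y₀ : F) : ℕ → ℝ → F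
  | 0 => fun _ => y₀
  | k + 1 => fun t => ∫ x in (0 : ℝ)..t, L x (dysonTerm L y₀ k x)

variable {F : Type*} [NormedAddCommGroup F] [NormedSpace ℝ F]

theorem continuous_dysonTerm {L : ℝ → F →L[ℝ] F} (hL : Continuous L) (y₀ : F) (k : ℕ) :
    Continuous (dysonTerm L y₀ k) := by
  induction k with
  | zero => exact continuous_const
  | succ k ih =>
    exact continuous_primitive (fun a b => (hL.clm_apply ih).intervalIntegrable a b) 0

theorem hasDerivAt_dysonTerm_succ [CompleteSpace F] {L : ℝ → F →L[ℝ] F} (hL : Continuous L)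
    (y₀ : F) (k : ℕ) (t : ℝ) :
    HasDerivAt (dysonTerm L y₀ (k + 1)) (L t (dysonTerm L y₀ k t)) t :=
  (hL.clm_apply (continuous_dysonTerm hL y₀ k)).integral_hasStrictDerivAt 0 t |>.hasDerivAt

theorem norm_dysonTerm_le {L : ℝ → F →L[ℝ] F} {K : ℝ} (hK : ∀ t, ‖L t‖ ≤ K)
    (y₀ : F) (k : ℕ) (t : ℝ) :
    ‖dysonTerm L y₀ k t‖ ≤ ‖y₀‖ * ((K * |t|) ^ k / k.factorial) := by
  have hK0 : 0 ≤ K := (norm_nonneg _).trans (hK 0)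
  induction k generalizing t with
  | zero => simp [dysonTerm]
  | succ k ih =>
    have hb : ∀ x, ‖L x (dysonTerm L y₀ k x)‖ ≤
        ‖y₀‖ * K ^ (k + 1) / k.factorial * |x| ^ k := fun x => by
      calc ‖L x (dysonTerm L y₀ k x)‖ ≤ K * (‖y₀‖ * ((K * |x|) ^ k / k.factorial)) :=
            ((L x).le_opNorm _).trans (mul_le_mul (hK x) (ih x) (norm_nonneg _) hK0)
        _ = _ := by rw [mul_pow]; ring
    have key : ‖∫ x in (0 : ℝ)..t, L x (dysonTerm L y₀ k x)‖ ≤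
        |∫ x in (0 : ℝ)..t, ‖y₀‖ * K ^ (k + 1) / k.factorial * |x| ^ k| := by
      refine norm_integral_le_abs_of_norm_le (Eventually.of_forall fun x => ?_) ?_
      · exact hb x
      · exact (by fun_prop : Continuous fun x : ℝ =>
          ‖y₀‖ * K ^ (k + 1) / k.factorial * |x| ^ k).intervalIntegrable _ _
    have hint : |∫ x in (0 : ℝ)..t, |x| ^ k| = |t| ^ (k + 1) / (k + 1) := by
      rcases le_total 0 t with h | h
      · have : ∫ x in (0 : ℝ)..t, |x| ^ k = ∫ x in (0 : ℝ)..t, x ^ k :=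
          integral_congr fun x hx => by
            rw [uIcc_of_le h] at hx
            simp only [abs_of_nonneg hx.1]
        rw [this, integral_pow, abs_of_nonneg h]
        simp only [ne_eq, Nat.add_eq_zero_iff, one_ne_zero, and_false, not_false_eq_true, zero_pow,
          sub_zero]
        exact abs_of_nonneg (by positivity)
      · have : ∫ x in (0 : ℝ)..t, |x| ^ k = ∫ x in (0 : ℝ)..t, (-x) ^ k :=
          integral_congr fun x hx => by
            rw [uIcc_of_ge h] at hx
            simp only [abs_of_nonpos hx.2]
        rw [this, integral_comp_neg (fun x => x ^ k), integral_pow, abs_of_nonpos h]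
        simp only [neg_zero, ne_eq, Nat.add_eq_zero_iff, one_ne_zero, and_false, not_false_eq_true,
          zero_pow, zero_sub, abs_div, abs_neg]
        have h' : 0 ≤ -t := by linarith
        rw [abs_of_nonneg (by positivity : 0 ≤ (-t) ^ (k + 1)),
          abs_of_nonneg (by positivity : (0 : ℝ) ≤ (k : ℝ) + 1)]
    rw [integral_const_mul, abs_mul, hint, abs_of_nonneg (by positivity)] at key
    refine key.trans (le_of_eq ?_)
    rw [Nat.factorial_succ, mul_pow]
    push_cast
    field_simp

/-- The factorial bound makes the Dyson series converge uniformly on bounded intervals, together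
with its termwise derivative. -/
theorem exists_solution_linear [CompleteSpace F] {L : ℝ → F →L[ℝ] F} (hL : Continuous L) {K : ℝ}
    (hK : ∀ t, ‖L t‖ ≤ K) (y₀ : F) :
    ∃ y : ℝ → F, y 0 = y₀ ∧ ∀ t ∈ Icc (0 : ℝ) 1, HasDerivAt y (L t (y t)) t := by
  have hK0 : 0 ≤ K := (norm_nonneg _).trans (hK 0)
  -- Summing on an open ball that contains `[0, 1]` gives two-sided derivatives at `0` and `1` too.
  have hball : ∀ t ∈ Metric.ball (0 : ℝ) 2, |t| ≤ 2 := fun t ht => by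
    simpa using (Metric.mem_ball.1 ht).le
  have hbd : ∀ k, ∀ t ∈ Metric.ball (0 : ℝ) 2, ‖dysonTerm L y₀ k t‖ ≤
      ‖y₀‖ * ((K * 2) ^ k / k.factorial) := fun k t ht => by
    refine (norm_dysonTerm_le hK y₀ k t).trans ?_
    gcongr
    exact hball t ht
  have hsum : Summable fun k : ℕ => ‖y₀‖ * ((K * 2) ^ k / k.factorial) :=
    (Real.summable_pow_div_factorial _).mul_left _
  have hs : ∀ t ∈ Metric.ball (0 : ℝ) 2, Summable fun k => dysonTerm L y₀ k t := fun t ht =>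
    Summable.of_norm_bounded hsum fun k => hbd k t ht
  have h0 : (0 : ℝ) ∈ Metric.ball (0 : ℝ) 2 := by simp
  refine ⟨fun t => ∑' k, dysonTerm L y₀ k t, ?_, fun t ht => ?_⟩
  · beta_reduce
    rw [tsum_eq_single 0]
    · rfl
    · rintro (_ | k) hk
      · exact absurd rfl hk
      · simp [dysonTerm]
  · have ht2 : t ∈ Metric.ball (0 : ℝ) 2 := by
      rw [Metric.mem_ball, Real.dist_eq, sub_zero, abs_of_nonneg ht.1]
      linarith [ht.2]
    have hd := hasDerivAt_tsum_of_isPreconnected (𝕜 := ℝ)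
      (g := fun k => dysonTerm L y₀ (k + 1)) (g' := fun k t => L t (dysonTerm L y₀ k t))
      (hsum.mul_left K) Metric.isOpen_ball (convex_ball (0 : ℝ) 2).isPreconnected
      (fun k x _ => hasDerivAt_dysonTerm_succ hL y₀ k x)
      (fun k x hx => ((L x).le_opNorm _).trans
        (mul_le_mul (hK x) (hbd k x hx) (norm_nonneg _) hK0)) h0
      ((summable_nat_add_iff 1).2 (hs 0 h0)) ht2
    rw [← (L t).map_tsum (hs t ht2)] at hd
    refine (hd.const_add y₀).congr_of_eventuallyEq ?_
    filter_upwards [Metric.isOpen_ball.mem_nhds ht2] with x hx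
    rw [(hs x hx).tsum_eq_zero_add]
    rfl

end LinearODE

/-! ### Fundamental solutions and their dependence on a parameter -/

section Transfer

variable {R : Type*} [NormedRing R] [NormedAlgebra ℂ R]

/-- `T` is the fundamental solution of `Y' = A Y` on `[0,1]`, and `S` is its inverse. -/
structure IsTransfer (A T S : ℝ → R) : Prop where
  left_zero : T 0 = 1
  right_zero : S 0 = 1
  hasDerivAt_left : ∀ t ∈ Icc (0 : ℝ) 1, HasDerivAt T (A t * T t) t
  hasDerivAt_right : ∀ t ∈ Icc (0 : ℝ) 1, HasDerivAt S (-(S t * A t)) t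

theorem eq_of_hasDerivAt_zero {F : Type*} [NormedAddCommGroup F] [NormedSpace ℝ F] {f : ℝ → F}
    (hf : ∀ t ∈ Icc (0 : ℝ) 1, HasDerivAt f 0 t) : ∀ t ∈ Icc (0 : ℝ) 1, f t = f 0 :=
  constant_of_has_deriv_right_zero (fun t ht => (hf t ht).continuousAt.continuousWithinAt)
    fun t ht => (hf t (Ico_subset_Icc_self ht)).hasDerivWithinAt

theorem exists_isTransfer [CompleteSpace R] {A : ℝ → R} (hA : Continuous A) {K : ℝ}
    (hK : ∀ t, ‖A t‖ ≤ K) : ∃ T S, IsTransfer A T S := by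
  have hL : Continuous fun t => ContinuousLinearMap.mul ℝ R (A t) :=
    (ContinuousLinearMap.mul ℝ R).continuous.comp hA
  have hL' : Continuous fun t => -(ContinuousLinearMap.mul ℝ R).flip (A t) :=
    ((ContinuousLinearMap.mul ℝ R).flip.continuous.comp hA).neg
  obtain ⟨T, hT0, hT⟩ := exists_solution_linear hL (K := K)
    (fun t => (ContinuousLinearMap.opNorm_mul_apply_le ℝ R (A t)).trans (hK t)) 1
  obtain ⟨S, hS0, hS⟩ := exists_solution_linear hL' (K := K)
    (fun t => by
      rw [norm_neg]
      refine (ContinuousLinearMap.opNorm_le_bound _ (norm_nonneg (A t)) fun x => ?_).trans (hK t)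
      simpa [mul_comm] using norm_mul_le x (A t)) 1
  exact ⟨T, S, hT0, hS0, fun t ht => by simpa using hT t ht, fun t ht => by simpa using hS t ht⟩




namespace IsTransfer

variable {A T S : ℝ → R}

theorem right_mul_left (h : IsTransfer A T S) : ∀ t ∈ Icc (0 : ℝ) 1, S t * T t = 1 := by
  intro t ht
  have := eq_of_hasDerivAt_zero (f := fun t => S t * T t) (fun t ht => by
    exact ((h.hasDerivAt_right t ht).mul (h.hasDerivAt_left t ht)).congr_deriv
      (by noncomm_ring)) t ht
  simpa [h.left_zero, h.right_zero] using this

theorem left_mul_right [IsDedekindFiniteMonoid R] (h : IsTransfer A T S) :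
    ∀ t ∈ Icc (0 : ℝ) 1, T t * S t = 1 := fun t ht =>
  mul_eq_one_comm.1 (h.right_mul_left t ht)

theorem eq_left_mul [IsDedekindFiniteMonoid R] (h : IsTransfer A T S) {V : ℝ → R}
    (hV : ∀ t ∈ Icc (0 : ℝ) 1, HasDerivAt V (A t * V t) t) :
    ∀ t ∈ Icc (0 : ℝ) 1, V t = T t * V 0 := by
  intro t ht
  have := eq_of_hasDerivAt_zero (f := fun t => S t * V t) (fun t ht => by
    exact ((h.hasDerivAt_right t ht).mul (hV t ht)).congr_deriv
      (by noncomm_ring)) t ht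
  simp only [h.right_zero, one_mul] at this
  rw [← this, ← mul_assoc, h.left_mul_right t ht, one_mul]

/-- For a Lax equation `B' = [A, B]`, the product `B T` satisfies the same linear equation as `T`,
with initial value `B 0`. -/
theorem left_mul_eq_mul_left (h : IsTransfer A T S) {B : ℝ → R}
    (hB : ∀ t ∈ Icc (0 : ℝ) 1, HasDerivAt B (A t * B t - B t * A t) t)
    [IsDedekindFiniteMonoid R] : ∀ t ∈ Icc (0 : ℝ) 1, T t * B 0 = B t * T t := by
  intro t ht
  have := h.eq_left_mul (V := fun t => B t * T t) (fun t ht => by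
    exact ((hB t ht).mul (h.hasDerivAt_left t ht)).congr_deriv
      (by noncomm_ring)) t ht
  simpa [h.left_zero] using this.symm

theorem continuousOn_left (h : IsTransfer A T S) : ContinuousOn T (Icc 0 1) := fun t ht =>
  (h.hasDerivAt_left t ht).continuousAt.continuousWithinAt

theorem continuousOn_right (h : IsTransfer A T S) : ContinuousOn S (Icc 0 1) := fun t ht =>
  (h.hasDerivAt_right t ht).continuousAt.continuousWithinAt

theorem norm_left_le (h : IsTransfer A T S) {K : ℝ} (hK : ∀ t, ‖A t‖ ≤ K) :
    ∀ t ∈ Icc (0 : ℝ) 1, ‖T t‖ ≤ ‖(1 : R)‖ * Real.exp K := by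
  intro t ht
  have hK0 : 0 ≤ K := (norm_nonneg _).trans (hK 0)
  have := norm_le_gronwallBound_of_norm_deriv_right_le (δ := ‖(1 : R)‖) (K := K) (ε := 0)
    h.continuousOn_left
    (fun x hx => (h.hasDerivAt_left x (Ico_subset_Icc_self hx)).hasDerivWithinAt)
    (by rw [h.left_zero])
    (fun x hx => by
      rw [add_zero]
      exact (norm_mul_le _ _).trans (mul_le_mul_of_nonneg_right (hK x) (norm_nonneg _))) t ht
  rw [gronwallBound_ε0, sub_zero] at this
  refine this.trans ?_
  gcongr
  nlinarith [ht.2]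

/-- Duhamel's formula: `(S T')' = S (A' - A) T'`, integrated from `0` to `t`. -/
theorem left_sub_left [CompleteSpace R] [IsDedekindFiniteMonoid R] {A' T' S' : ℝ → R}
    (h : IsTransfer A T S) (h' : IsTransfer A' T' S') (hA : Continuous A) (hA' : Continuous A') :
    ∀ t ∈ Icc (0 : ℝ) 1,
      T' t - T t = T t * ∫ x in (0 : ℝ)..t, S x * (A' x - A x) * T' x := by
  intro t ht
  have hsub : uIcc 0 t ⊆ Icc (0 : ℝ) 1 := by
    rw [uIcc_of_le ht.1]
    exact Icc_subset_Icc_right ht.2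
  have hint : IntervalIntegrable (fun x => S x * (A' x - A x) * T' x) MeasureTheory.volume 0 t :=
    ((((h.continuousOn_right.mono hsub).mul (hA'.sub hA).continuousOn)).mul
      (h'.continuousOn_left.mono hsub)).intervalIntegrable
  have hd : ∀ x ∈ uIcc 0 t, HasDerivAt (fun x => S x * T' x) (S x * (A' x - A x) * T' x) x := by
    intro x hx
    exact ((h.hasDerivAt_right x (hsub hx)).mul (h'.hasDerivAt_left x (hsub hx))).congr_deriv
      (by noncomm_ring)
  rw [integral_eq_sub_of_hasDerivAt hd hint, h.right_zero, h'.left_zero, mul_sub, ← mul_assoc,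
    h.left_mul_right t ht]
  simp

end IsTransfer

/-- The fundamental solution of `Y' = (A₀ + E N) Y` at time `1` is differentiable in `E`. -/
theorem hasDerivAt_transfer_param [CompleteSpace R] [IsDedekindFiniteMonoid R] {A₀ : ℝ → R} {N : R}
    (hA₀ : Continuous A₀) {K : ℝ} (hK : ∀ t, ‖A₀ t‖ ≤ K) {T S : ℂ → ℝ → R}
    (h : ∀ E, IsTransfer (fun t => A₀ t + E • N) (T E) (S E)) (E : ℂ) :
    HasDerivAt (fun E => T E 1) (T E 1 * ∫ x in (0 : ℝ)..1, S E x * N * T E x) E := by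
  have h01 : (1 : ℝ) ∈ Icc (0 : ℝ) 1 := by simp
  have hcont : ∀ E : ℂ, Continuous fun t => A₀ t + E • N := fun E => hA₀.add continuous_const
  have hu : uIcc (0 : ℝ) 1 = Icc 0 1 := uIcc_of_le zero_le_one
  -- bounds for `T`, `S`
  obtain ⟨CS, hCS⟩ := isCompact_Icc.exists_bound_of_continuousOn (h E).continuousOn_right
  obtain ⟨CT, hCT⟩ := isCompact_Icc.exists_bound_of_continuousOn (h E).continuousOn_left
  have hCS0 : 0 ≤ CS := (norm_nonneg _).trans (hCS 1 h01)
  have hCT0 : 0 ≤ CT := (norm_nonneg _).trans (hCT 1 h01)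
  set C' : ℝ := ‖(1 : R)‖ * Real.exp (K + (‖E‖ + 1) * ‖N‖) with hC'
  have hC'0 : 0 ≤ C' := by positivity
  -- Duhamel's integral contains the perturbed solution `T E'`, so a bound uniform for `E'` near `E`
  -- is needed.
  have hbT : ∀ E' : ℂ, ‖E' - E‖ ≤ 1 → ∀ t ∈ Icc (0 : ℝ) 1, ‖T E' t‖ ≤ C' := by
    intro E' hE' t ht
    refine (h E').norm_left_le (fun t => (norm_add_le _ _).trans (add_le_add (hK t) ?_)) t ht
    rw [norm_smul]
    gcongr
    calc ‖E'‖ = ‖E + (E' - E)‖ := by congr 1; ring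
      _ ≤ ‖E‖ + ‖E' - E‖ := norm_add_le _ _
      _ ≤ _ := by gcongr
  have hform : ∀ E' : ℂ, ∀ t ∈ Icc (0 : ℝ) 1,
      T E' t - T E t = T E t * ((E' - E) • ∫ x in (0 : ℝ)..t, S E x * N * T E' x) := by
    intro E' t ht
    rw [(h E).left_sub_left (h E') (hcont E) (hcont E') t ht, ← integral_smul]
    congr 2
    ext x
    rw [add_sub_add_left_eq_sub, ← sub_smul, mul_smul_comm, smul_mul_assoc]
  have hdiff : ∀ E' : ℂ, ‖E' - E‖ ≤ 1 → ∀ t ∈ Icc (0 : ℝ) 1,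
      ‖T E' t - T E t‖ ≤ CT * (CS * ‖N‖ * C') * ‖E' - E‖ := by
    intro E' hE' t ht
    rw [hform E' t ht]
    have hI : ‖∫ x in (0 : ℝ)..t, S E x * N * T E' x‖ ≤ CS * ‖N‖ * C' := by
      refine (norm_integral_le_of_norm_le_const (C := CS * ‖N‖ * C') fun x hx => ?_).trans ?_
      · rw [uIoc_of_le ht.1] at hx
        have hx' : x ∈ Icc (0 : ℝ) 1 := ⟨hx.1.le, hx.2.trans ht.2⟩
        refine (norm_mul_le _ _).trans (mul_le_mul ((norm_mul_le _ _).trans ?_) (hbT E' hE' x hx')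
          (norm_nonneg _) (by positivity))
        gcongr
        exact hCS x hx'
      · rw [sub_zero, abs_of_nonneg ht.1]
        exact mul_le_of_le_one_right (by positivity) ht.2
    refine (norm_mul_le _ _).trans ?_
    rw [norm_smul]
    calc ‖T E t‖ * (‖E' - E‖ * ‖∫ x in (0 : ℝ)..t, S E x * N * T E' x‖)
        ≤ CT * (‖E' - E‖ * (CS * ‖N‖ * C')) := by
          gcongr
          exact hCT t ht
      _ = _ := by ring
  have hii : ∀ E' : ℂ, IntervalIntegrable (fun x => S E x * N * T E' x)
      MeasureTheory.volume 0 1 := fun E' => by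
    refine ContinuousOn.intervalIntegrable ?_
    rw [hu]
    exact ((h E).continuousOn_right.mul continuousOn_const).mul (h E').continuousOn_left
  -- Replacing `T E'` by `T E` under Duhamel's integral costs a second factor `‖E' - E‖`; the
  -- remainder is quadratic.
  have hmain : ∀ E' : ℂ, ‖E' - E‖ ≤ 1 →
      ‖T E' 1 - T E 1 - (E' - E) • (T E 1 * ∫ x in (0 : ℝ)..1, S E x * N * T E x)‖ ≤
        CT * (CS * ‖N‖ * (CT * (CS * ‖N‖ * C'))) * ‖E' - E‖ ^ 2 := by
    intro E' hE'
    rw [hform E' 1 h01, mul_smul_comm, ← smul_sub, ← mul_sub, ← integral_sub (hii E') (hii E),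
      norm_smul]
    have hI : ‖∫ x in (0 : ℝ)..1, S E x * N * T E' x - S E x * N * T E x‖ ≤
        CS * ‖N‖ * (CT * (CS * ‖N‖ * C') * ‖E' - E‖) := by
      refine (norm_integral_le_of_norm_le_const
        (C := CS * ‖N‖ * (CT * (CS * ‖N‖ * C') * ‖E' - E‖)) fun x hx => ?_).trans (by simp)
      rw [uIoc_of_le zero_le_one] at hx
      have hx' : x ∈ Icc (0 : ℝ) 1 := ⟨hx.1.le, hx.2⟩
      rw [← mul_sub]
      refine (norm_mul_le _ _).trans (mul_le_mul ((norm_mul_le _ _).trans ?_)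
        (hdiff E' hE' x hx') (norm_nonneg _) (by positivity))
      gcongr
      exact hCS x hx'
    calc ‖E' - E‖ * ‖T E 1 * ∫ x in (0 : ℝ)..1, S E x * N * T E' x - S E x * N * T E x‖
        ≤ ‖E' - E‖ * (CT * (CS * ‖N‖ * (CT * (CS * ‖N‖ * C') * ‖E' - E‖))) := by
          gcongr
          refine (norm_mul_le _ _).trans ?_
          gcongr
          exact hCT 1 h01
      _ = _ := by ring
  rw [hasDerivAt_iff_isLittleO]
  refine Asymptotics.IsBigO.trans_isLittleO (g := fun E' => ‖E' - E‖ ^ 2) ?_ ?_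
  · refine Asymptotics.IsBigO.of_bound (CT * (CS * ‖N‖ * (CT * (CS * ‖N‖ * C')))) ?_
    filter_upwards [Metric.closedBall_mem_nhds E one_pos] with E' hE'
    rw [Metric.mem_closedBall, dist_eq_norm] at hE'
    simpa using hmain E' hE'
  · have : (fun E' : ℂ => ‖E' - E‖ ^ 2) =o[𝓝 E] fun E' => ‖E' - E‖ := by
      have ht : Tendsto (fun E' : ℂ => ‖E' - E‖) (𝓝 E) (𝓝 0) := by
        have : Continuous fun E' : ℂ => ‖E' - E‖ := by fun_prop
        simpa using this.tendsto E
      exact (Asymptotics.isLittleO_pow_id one_lt_two).comp_tendsto ht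
    exact Asymptotics.isLittleO_norm_right.1 this

end Transfer

end Inozemtsev

end

noncomputable section

namespace Inozemtsev

open Set intervalIntegral

/-! ### The monodromy matrix and its derivative in `E` -/

section MatrixMonodromy

open scoped Matrix.Norms.Operator

theorem hasDerivAt_matrix {M : ℝ → Matrix (Fin 2) (Fin 2) ℂ} {M' : Matrix (Fin 2) (Fin 2) ℂ} {t : ℝ}
    (h : ∀ i j, HasDerivAt (fun t => M t i j) (M' i j) t) : HasDerivAt M M' t := by
  have key : ∀ X : Matrix (Fin 2) (Fin 2) ℂ,
      X = ∑ i, ∑ j, X i j • Matrix.single i j (1 : ℂ) := fun X => by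
    conv_lhs => rw [Matrix.matrix_eq_sum_single X]
    simp
  have : HasDerivAt (fun t => ∑ i, ∑ j, M t i j • Matrix.single i j (1 : ℂ))
      (∑ i, ∑ j, M' i j • Matrix.single i j (1 : ℂ)) t :=
    HasDerivAt.fun_sum fun i _ => HasDerivAt.fun_sum fun j _ => (h i j).smul_const _
  rw [key M']
  exact this.congr_of_eventuallyEq (Eventually.of_forall fun t => key (M t))

/-- The linear functional `M ↦ tr (M X)`. -/
def traceMul (X : Matrix (Fin 2) (Fin 2) ℂ) : Matrix (Fin 2) (Fin 2) ℂ →L[ℂ] ℂ :=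
  LinearMap.toContinuousLinearMap
    ((Matrix.traceLinearMap (Fin 2) ℂ ℂ).comp (LinearMap.mulRight ℂ X))

@[simp]
theorem traceMul_apply (X M : Matrix (Fin 2) (Fin 2) ℂ) : traceMul X M = (M * X).trace := rfl

/-- A `2 × 2` matrix commuting with a nonzero traceless matrix is a polynomial in it. -/
theorem exists_eq_of_commute {a b c : ℂ} (h0 : ¬(a = 0 ∧ b = 0 ∧ c = 0))
    {M : Matrix (Fin 2) (Fin 2) ℂ} (h : M * !![a, b; c, -a] = !![a, b; c, -a] * M) :
    ∃ β : ℂ, β * (2 * a) = M 0 0 - M 1 1 ∧ β * b = M 0 1 ∧ β * c = M 1 0 := by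
  have h00 := congrFun (congrFun h 0) 0
  have h01 := congrFun (congrFun h 0) 1
  have h10 := congrFun (congrFun h 1) 0
  simp [Matrix.mul_apply, Fin.sum_univ_two] at h00 h01 h10
  by_cases ha : a = 0
  · by_cases hb : b = 0
    · have hc : c ≠ 0 := fun hc => h0 ⟨ha, hb, hc⟩
      subst ha hb
      refine ⟨M 1 0 / c, ?_, ?_, by field_simp⟩
      · have : c * (M 0 0 - M 1 1) = 0 := by linear_combination -h10
        rw [(mul_eq_zero.1 this).resolve_left hc]; ring
      · have : c * M 0 1 = 0 := by linear_combination h00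
        rw [(mul_eq_zero.1 this).resolve_left hc]; ring
    · subst ha
      refine ⟨M 0 1 / b, ?_, by field_simp, ?_⟩
      · have : b * (M 0 0 - M 1 1) = 0 := by linear_combination h01
        rw [(mul_eq_zero.1 this).resolve_left hb]; ring
      · field_simp
        linear_combination h00
  · refine ⟨(M 0 0 - M 1 1) / (2 * a), by field_simp, ?_, ?_⟩
    · field_simp
      linear_combination h01
    · field_simp
      linear_combination -h10

/-- A family `Ξ₀` of functions of `x ∈ U`, depending on a parameter `E`, solving the equation of
products of solutions of `f'' = (u - E) f`; `Ξ₁`, `Ξ₂` are its derivatives in `x`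
and `Q` is its first integral. -/
structure IsProductFamily (U : Set ℂ) (u u' : ℂ → ℂ) (Ξ₀ Ξ₁ Ξ₂ : ℂ → ℂ → ℂ) (Q : ℂ → ℂ) : Prop where
  hasDerivAt_potential : ∀ x ∈ U, HasDerivAt u (u' x) x
  hasDerivAt_zero : ∀ E, ∀ x ∈ U, HasDerivAt (fun x => Ξ₀ x E) (Ξ₁ x E) x
  hasDerivAt_one : ∀ E, ∀ x ∈ U, HasDerivAt (fun x => Ξ₁ x E) (Ξ₂ x E) x
  hasDerivAt_two : ∀ E, ∀ x ∈ U,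
    HasDerivAt (fun x => Ξ₂ x E) (4 * (u x - E) * Ξ₁ x E + 2 * u' x * Ξ₀ x E) x
  integral_eq : ∀ E, ∀ x ∈ U,
    Q E = Ξ₀ x E ^ 2 * (E - u x) + 1 / 2 * Ξ₀ x E * Ξ₂ x E - 1 / 4 * Ξ₁ x E ^ 2
  differentiable_zero : ∀ x ∈ U, Differentiable ℂ (Ξ₀ x)
  differentiable_one : ∀ x ∈ U, Differentiable ℂ (Ξ₁ x)
  differentiable_two : ∀ x ∈ U, Differentiable ℂ (Ξ₂ x)

/-- The coefficient matrix of the system `f' = g`, `g' = (u - E) f` along the segment from `ε` to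
`ε + P`, at `E = 0`. -/
def segmentMatrix (u : ℂ → ℂ) (ε P : ℂ) (t : ℝ) : Matrix (Fin 2) (Fin 2) ℂ :=
  !![0, P; P * u (ε + ((projIcc (0 : ℝ) 1 zero_le_one t : ℝ) : ℂ) * P), 0]

/-- The derivative in `E` of the coefficient matrix of the system `f' = g`, `g' = (u - E) f`. -/
def paramMatrix (P : ℂ) : Matrix (Fin 2) (Fin 2) ℂ := !![0, 0; -P, 0]

/-- The matrix of the operator `f ↦ Ξ f' - Ξ' f / 2` on the solutions of `f'' = (u - E) f`. -/
def productMatrix (u : ℂ → ℂ) (Ξ₀ Ξ₁ Ξ₂ : ℂ → ℂ → ℂ) (x E : ℂ) : Matrix (Fin 2) (Fin 2) ℂ :=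
  !![-Ξ₁ x E / 2, Ξ₀ x E; Ξ₀ x E * (u x - E) - Ξ₂ x E / 2, Ξ₁ x E / 2]

variable {U : Set ℂ} {u u' : ℂ → ℂ} {ε P : ℂ}

theorem segmentMatrix_add (E : ℂ) {t : ℝ} (ht : t ∈ Icc (0 : ℝ) 1) :
    segmentMatrix u ε P t + E • paramMatrix P = !![0, P; P * (u (ε + t * P) - E), 0] := by
  ext i j
  fin_cases i <;> fin_cases j <;> simp [segmentMatrix, paramMatrix, projIcc_of_mem zero_le_one ht]
  ring

/-- The clamping by `projIcc` makes the matrix continuous and bounded on all of `ℝ`, as the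
existence theorem requires, while only `[0, 1]` matters. -/
theorem continuous_segmentMatrix (hu : ContinuousOn u U)
    (hU : ∀ t ∈ Icc (0 : ℝ) 1, ε + t * P ∈ U) : Continuous (segmentMatrix u ε P) := by
  have : Continuous fun t : ℝ => u (ε + ((projIcc (0 : ℝ) 1 zero_le_one t : ℝ) : ℂ) * P) := by
    refine hu.comp_continuous ?_ fun t => hU _ (projIcc (0 : ℝ) 1 zero_le_one t).2
    have : Continuous fun t : ℝ => (projIcc (0 : ℝ) 1 zero_le_one t : ℝ) :=
      continuous_subtype_val.comp continuous_projIcc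
    fun_prop
  refine continuous_matrix fun i j => ?_
  fin_cases i <;> fin_cases j <;> simp [segmentMatrix]
  · exact continuous_const
  · exact continuous_const
  · exact continuous_const.mul this
  · exact continuous_const

theorem exists_norm_segmentMatrix_le (hu : ContinuousOn u U)
    (hU : ∀ t ∈ Icc (0 : ℝ) 1, ε + t * P ∈ U) : ∃ K, ∀ t, ‖segmentMatrix u ε P t‖ ≤ K := by
  obtain ⟨K, hK⟩ := isCompact_Icc.exists_bound_of_continuousOn
    (continuous_segmentMatrix hu hU).continuousOn (s := Icc (0 : ℝ) 1)
  refine ⟨K, fun t => ?_⟩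
  have := hK _ (projIcc (0 : ℝ) 1 zero_le_one t).2
  simpa [segmentMatrix] using this

theorem exists_isTransfer_segment (hu : ContinuousOn u U)
    (hU : ∀ t ∈ Icc (0 : ℝ) 1, ε + t * P ∈ U) (E : ℂ) :
    ∃ T S, IsTransfer (fun t => segmentMatrix u ε P t + E • paramMatrix P) T S := by
  obtain ⟨K, hK⟩ := exists_norm_segmentMatrix_le hu hU
  exact exists_isTransfer (K := K + ‖E • paramMatrix P‖)
    ((continuous_segmentMatrix hu hU).add continuous_const)
    fun t => (norm_add_le _ _).trans (by gcongr; exact hK t)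

theorem hasDerivAt_comp_segment {f : ℂ → ℂ} {f' : ℂ} {t : ℝ}
    (h : HasDerivAt f f' (ε + t * P)) : HasDerivAt (fun t : ℝ => f (ε + t * P)) (P * f') t := by
  have h1 : HasDerivAt (fun t : ℝ => ε + (t : ℂ) * P) P t := by
    simpa using ((Complex.ofRealCLM.hasDerivAt (x := t)).mul_const P).const_add ε
  exact h.scomp t h1

variable {Ξ₀ Ξ₁ Ξ₂ : ℂ → ℂ → ℂ} {Q : ℂ → ℂ}

namespace IsProductFamily

theorem continuousOn_potential (h : IsProductFamily U u u' Ξ₀ Ξ₁ Ξ₂ Q) : ContinuousOn u U :=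
  fun x hx => (h.hasDerivAt_potential x hx).continuousAt.continuousWithinAt

/-- The Lax form of the third order equation, which enters through the lower left entry; the other
entries use only that `Ξ₁` and `Ξ₂` are the successive derivatives. -/
theorem hasDerivAt_productMatrix (h : IsProductFamily U u u' Ξ₀ Ξ₁ Ξ₂ Q)
    (hU : ∀ t ∈ Icc (0 : ℝ) 1, ε + t * P ∈ U) (E : ℂ) : ∀ t ∈ Icc (0 : ℝ) 1,
    HasDerivAt (fun t : ℝ => productMatrix u Ξ₀ Ξ₁ Ξ₂ (ε + t * P) E)
      ((segmentMatrix u ε P t + E • paramMatrix P) * productMatrix u Ξ₀ Ξ₁ Ξ₂ (ε + t * P) E -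
        productMatrix u Ξ₀ Ξ₁ Ξ₂ (ε + t * P) E * (segmentMatrix u ε P t + E • paramMatrix P)) t := by
  intro t ht
  have d0 := hasDerivAt_comp_segment (h.hasDerivAt_zero E _ (hU t ht))
  have d1 := hasDerivAt_comp_segment (h.hasDerivAt_one E _ (hU t ht))
  have d2 := hasDerivAt_comp_segment (h.hasDerivAt_two E _ (hU t ht))
  have du := hasDerivAt_comp_segment (h.hasDerivAt_potential _ (hU t ht))
  rw [segmentMatrix_add E ht]
  refine hasDerivAt_matrix fun i j => ?_
  fin_cases i <;> fin_cases j <;>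
    simp [productMatrix, -mul_eq_mul_left_iff]
  · exact (d1.neg.div_const 2).congr_deriv (by ring)
  · exact d0.congr_deriv (by ring)
  · exact ((d0.fun_mul (du.sub_const E)).sub (d2.div_const 2)).congr_deriv (by ring)
  · exact (d1.div_const 2).congr_deriv (by ring)

/-- Cayley–Hamilton for a traceless matrix whose determinant is the first integral `Q`. -/
theorem productMatrix_mul_self (h : IsProductFamily U u u' Ξ₀ Ξ₁ Ξ₂ Q) (E : ℂ) {x : ℂ} (hx : x ∈ U) :
    productMatrix u Ξ₀ Ξ₁ Ξ₂ x E * productMatrix u Ξ₀ Ξ₁ Ξ₂ x E = (-Q E) • 1 := by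
  rw [h.integral_eq E x hx]
  ext i j
  fin_cases i <;> fin_cases j <;> simp [productMatrix, Matrix.mul_apply, Fin.sum_univ_two] <;> ring

/-- A product of solutions that vanishes to third order at a point vanishes near it. -/
theorem eventually_eq_zero (h : IsProductFamily U u u' Ξ₀ Ξ₁ Ξ₂ Q) (hUo : IsOpen U) {E : ℂ}
    (hε : ε ∈ U) (h0 : Ξ₀ ε E = 0) (h1 : Ξ₁ ε E = 0) (h2 : Ξ₂ ε E = 0) :
    ∀ᶠ x in 𝓝 ε, Ξ₀ x E = 0 := by
  obtain ⟨r, hr, hball⟩ := Metric.isOpen_iff.1 hUo ε hε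
  filter_upwards [Metric.ball_mem_nhds ε hr] with y hy
  have hU : ∀ t ∈ Icc (0 : ℝ) 1, ε + t * (y - ε) ∈ U := fun t ht => hball <| by
    rw [Metric.mem_ball, dist_eq_norm] at hy ⊢
    rw [add_sub_cancel_left, norm_mul, Complex.norm_real, Real.norm_of_nonneg ht.1]
    exact (mul_le_of_le_one_left (norm_nonneg _) ht.2).trans_lt hy
  obtain ⟨T, S, hT⟩ := exists_isTransfer_segment h.continuousOn_potential hU E
  have h01 : (1 : ℝ) ∈ Icc (0 : ℝ) 1 := by simp
  have key := hT.left_mul_eq_mul_left (h.hasDerivAt_productMatrix hU E) 1 h01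
  have hz : productMatrix u Ξ₀ Ξ₁ Ξ₂ (ε + (0 : ℝ) * (y - ε)) E = 0 := by
    ext i j
    fin_cases i <;> fin_cases j <;> simp [productMatrix, h0, h1, h2]
  rw [hz, mul_zero] at key
  have := congrArg (· * S 1) key
  simp only [zero_mul, mul_assoc, hT.left_mul_right 1 h01, mul_one] at this
  simpa [productMatrix] using (congrFun (congrFun this 0) 1).symm

/-- The monodromy of `f'' = (u - E) f` along a period segment has the form `α + β B`, `B` being the
operator `f ↦ Ξ f' - Ξ' f / 2`; here are the coefficients and their derivatives in `E`. -/
theorem exists_monodromy (h : IsProductFamily U u u' Ξ₀ Ξ₁ Ξ₂ Q)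
    (hU : ∀ t ∈ Icc (0 : ℝ) 1, ε + t * P ∈ U) (hu : u (ε + P) = u ε)
    (hp₀ : Ξ₀ (ε + P) = Ξ₀ ε) (hp₁ : Ξ₁ (ε + P) = Ξ₁ ε) (hp₂ : Ξ₂ (ε + P) = Ξ₂ ε)
    (hne : ∀ E, ¬(Ξ₀ ε E = 0 ∧ Ξ₁ ε E = 0 ∧ Ξ₂ ε E = 0)) :
    ∃ α β : ℂ → ℂ, ∀ E,
      α E ^ 2 + β E ^ 2 * Q E ≠ 0 ∧
      HasDerivAt α (-(β E * ∫ t in (0 : ℝ)..1, Ξ₀ (ε + t * P) E * P) / 2) E ∧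
      (∃ β' Q' : ℂ, HasDerivAt β β' E ∧ HasDerivAt Q Q' E ∧
        2 * Q E * β' + Q' * β E = α E * ∫ t in (0 : ℝ)..1, Ξ₀ (ε + t * P) E * P) ∧
      ∀ f f' : ℂ → ℂ, (∀ x ∈ U, HasDerivAt f (f' x) x) →
        (∀ x ∈ U, HasDerivAt f' ((u x - E) * f x) x) → ∀ s,
        Ξ₀ ε E * f' ε - Ξ₁ ε E / 2 * f ε = s * f ε →
        (Ξ₀ ε E * (u ε - E) - Ξ₂ ε E / 2) * f ε + Ξ₁ ε E / 2 * f' ε = s * f' ε →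
        f (ε + P) = (α E + β E * s) * f ε ∧ f' (ε + P) = (α E + β E * s) * f' ε := by
  have h01 : (1 : ℝ) ∈ Icc (0 : ℝ) 1 := by simp
  have hεU : ε ∈ U := by simpa using hU 0 (by simp)
  choose T S hT using exists_isTransfer_segment h.continuousOn_potential hU
  set B : ℂ → ℂ → Matrix (Fin 2) (Fin 2) ℂ := productMatrix u Ξ₀ Ξ₁ Ξ₂ with hB
  have hBsq : ∀ E, ∀ x ∈ U, B x E * B x E = (-Q E) • 1 := fun E x hx =>
    h.productMatrix_mul_self E hx
  have hB1 : ∀ E, B (ε + (1 : ℝ) * P) E = B ε E := fun E => by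
    simp [hB, productMatrix, hu, hp₀, hp₁, hp₂]
  have hconj : ∀ E, ∀ t ∈ Icc (0 : ℝ) 1, T E t * B ε E = B (ε + t * P) E * T E t :=
    fun E t ht => by
      simpa [hB] using (hT E).left_mul_eq_mul_left (h.hasDerivAt_productMatrix hU E) t ht
  -- By periodicity `B` is the same matrix at both ends, so `T E 1` commutes with it; being
  -- traceless and nonzero, it has only the combinations of `1` and itself as commutant.
  have hβex : ∀ E, ∃ β : ℂ, β * (-Ξ₁ ε E) = T E 1 0 0 - T E 1 1 1 ∧ β * Ξ₀ ε E = T E 1 0 1 ∧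
      β * (Ξ₀ ε E * (u ε - E) - Ξ₂ ε E / 2) = T E 1 1 0 := fun E => by
    have hc := hconj E 1 h01
    rw [hB1] at hc
    obtain ⟨β, h1, h2, h3⟩ := exists_eq_of_commute (a := -Ξ₁ ε E / 2) (b := Ξ₀ ε E)
      (c := Ξ₀ ε E * (u ε - E) - Ξ₂ ε E / 2) (M := T E 1) (by
        rintro ⟨h1, h0, h2⟩
        refine hne E ⟨h0, by simpa using h1, ?_⟩
        rw [h0, zero_mul, zero_sub, neg_eq_zero] at h2
        simpa using h2) (by simpa [hB, productMatrix, neg_div] using hc)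
    exact ⟨β, by rw [← h1]; ring, h2, h3⟩
  choose β hβ1 hβ2 hβ3 using hβex
  set α : ℂ → ℂ := fun E => (T E 1).trace / 2 with hα
  have hTeq : ∀ E, T E 1 = α E • (1 : Matrix (Fin 2) (Fin 2) ℂ) + β E • B ε E := fun E => by
    have e1 := hβ1 E
    have e2 := hβ2 E
    have e3 := hβ3 E
    ext i j
    fin_cases i <;> fin_cases j <;> simp [hα, hB, productMatrix, Matrix.trace, Fin.sum_univ_two]
    · linear_combination -e1 / 2
    · exact e2.symm
    · exact e3.symm
    · linear_combination e1 / 2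
  obtain ⟨K, hK⟩ := exists_norm_segmentMatrix_le h.continuousOn_potential hU
  have hTd : ∀ E, HasDerivAt (fun E => T E 1)
      (T E 1 * ∫ x in (0 : ℝ)..1, S E x * paramMatrix P * T E x) E :=
    hasDerivAt_transfer_param (continuous_segmentMatrix h.continuousOn_potential hU) hK hT
  -- derivatives of traces
  have htr : ∀ E X, ((T E 1 * ∫ x in (0 : ℝ)..1, S E x * paramMatrix P * T E x) * X).trace =
      ∫ x in (0 : ℝ)..1, (T E 1 * (S E x * paramMatrix P * T E x) * X).trace := fun E X => by
    have hc : ContinuousOn (fun x => S E x * paramMatrix P * T E x) (uIcc 0 1) := by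
      rw [uIcc_of_le zero_le_one]
      exact ((hT E).continuousOn_right.mul continuousOn_const).mul (hT E).continuousOn_left
    exact (((traceMul X).comp (ContinuousLinearMap.mul ℂ _ (T E 1))).intervalIntegral_comp_comm
      (hc.intervalIntegrable (μ := MeasureTheory.volume))).symm
  have hNtr : ∀ X : Matrix (Fin 2) (Fin 2) ℂ, (paramMatrix P * X).trace = -P * X 0 1 := fun X => by
    rw [Matrix.trace_fin_two, Matrix.mul_apply, Matrix.mul_apply]
    simp [paramMatrix, Fin.sum_univ_two]
  have hconjS : ∀ E, ∀ t ∈ Icc (0 : ℝ) 1, T E t * B ε E * S E t = B (ε + t * P) E :=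
    fun E t ht => by rw [hconj E t ht, mul_assoc, (hT E).left_mul_right t ht, mul_one]
  -- By cyclicity of the trace, `T E 1` is replaced by `T E x * T E 1 * S E x`, the monodromy based
  -- at `ε + x P`, that is `α + β B(ε + x P)`. Its trace against the parameter matrix picks out the
  -- upper right entry `β Ξ`.
  have htr1 : ∀ E, ((T E 1 * ∫ x in (0 : ℝ)..1, S E x * paramMatrix P * T E x) * 1).trace =
      -(β E * ∫ t in (0 : ℝ)..1, Ξ₀ (ε + t * P) E * P) := fun E => by
    rw [htr, ← intervalIntegral.integral_const_mul, ← intervalIntegral.integral_neg]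
    refine integral_congr fun x hx => ?_
    rw [uIcc_of_le zero_le_one] at hx
    have : T E x * T E 1 * S E x = α E • 1 + β E • B (ε + x * P) E := by
      rw [hTeq, mul_add, add_mul, mul_smul_comm, smul_mul_assoc, mul_one,
        (hT E).left_mul_right x hx, mul_smul_comm, smul_mul_assoc, hconjS E x hx]
    calc (T E 1 * (S E x * paramMatrix P * T E x) * 1).trace
        = (T E 1 * S E x * (paramMatrix P * T E x)).trace := by simp only [mul_assoc, mul_one]
      _ = (paramMatrix P * (T E x * T E 1 * S E x)).trace := by
          rw [Matrix.trace_mul_comm]; simp only [mul_assoc]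
      _ = _ := by
          rw [this, hNtr]
          simp [hB, productMatrix]
          ring
  have htr2 : ∀ E, ((T E 1 * ∫ x in (0 : ℝ)..1, S E x * paramMatrix P * T E x) * B ε E).trace =
      -(α E * ∫ t in (0 : ℝ)..1, Ξ₀ (ε + t * P) E * P) := fun E => by
    rw [htr, ← intervalIntegral.integral_const_mul, ← intervalIntegral.integral_neg]
    refine integral_congr fun x hx => ?_
    rw [uIcc_of_le zero_le_one] at hx
    have : T E x * B ε E * T E 1 * S E x = α E • B (ε + x * P) E - (β E * Q E) • 1 := by
      rw [hTeq, mul_add, add_mul, mul_smul_comm, smul_mul_assoc, mul_one, hconjS E x hx,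
        mul_smul_comm, smul_mul_assoc, mul_assoc (T E x), hBsq E ε hεU, mul_smul_comm, mul_one,
        smul_mul_assoc, (hT E).left_mul_right x hx, smul_smul, mul_neg, neg_smul, sub_eq_add_neg]
    calc (T E 1 * (S E x * paramMatrix P * T E x) * B ε E).trace
        = (T E 1 * S E x * (paramMatrix P * (T E x * B ε E))).trace := by simp only [mul_assoc]
      _ = (paramMatrix P * (T E x * B ε E * T E 1 * S E x)).trace := by
          rw [Matrix.trace_mul_comm]; simp only [mul_assoc]
      _ = _ := by
          rw [this, hNtr]
          simp [hB, productMatrix]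
          ring
  have hαd : ∀ E, HasDerivAt α (-(β E * ∫ t in (0 : ℝ)..1, Ξ₀ (ε + t * P) E * P) / 2) E :=
    fun E => by
      have := ((traceMul 1).hasFDerivAt.comp_hasDerivAt E (hTd E)).div_const 2
      refine (this.congr_deriv ?_).congr_of_eventuallyEq (Eventually.of_forall fun E => ?_)
      · exact congrArg (· / 2) (htr1 E)
      · simp [hα]
  have hent : ∀ i j, Differentiable ℂ fun E => T E 1 i j := fun i j E => by
    have := ((traceMul (Matrix.single j i 1)).hasFDerivAt.comp_hasDerivAt E (hTd E))
    refine this.differentiableAt.congr_of_eventuallyEq (Eventually.of_forall fun E => ?_)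
    simp [Matrix.trace_mul_single]
  have hd0 := h.differentiable_zero ε hεU
  have hd1 := h.differentiable_one ε hεU
  have hd2 := h.differentiable_two ε hεU
  -- `β` was chosen separately for each `E`. Near any given `E` some entry of `B` is nonzero, and
  -- there `β` is a quotient of differentiable functions.
  have hβd : Differentiable ℂ β := fun E => by
    have hratio : ∀ n d : ℂ → ℂ, Differentiable ℂ n → Differentiable ℂ d →
        (∀ E, β E * d E = n E) → d E ≠ 0 → DifferentiableAt ℂ β E := fun n d hn hd hβ hdE => by
      refine ((hn E).div (hd E) hdE).congr_of_eventuallyEq ?_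
      filter_upwards [(hd E).continuousAt.eventually_ne hdE] with E' hE'
      rw [Pi.div_apply, ← hβ E', mul_div_cancel_right₀ _ hE']
    by_cases c1 : Ξ₁ ε E = 0
    · by_cases c0 : Ξ₀ ε E = 0
      · refine hratio _ (fun E => Ξ₀ ε E * (u ε - E) - Ξ₂ ε E / 2) (hent 1 0) (by fun_prop) hβ3 ?_
        have c2 : Ξ₂ ε E ≠ 0 := fun c2 => hne E ⟨c0, c1, c2⟩
        simpa [c0] using c2
      · exact hratio _ _ (hent 0 1) hd0 hβ2 c0
    · exact hratio _ (fun E => -Ξ₁ ε E) ((hent 0 0).sub (hent 1 1)) (by fun_prop) hβ1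
        (by simpa using c1)
  refine ⟨α, β, fun E => ⟨?_, hαd E, ?_, ?_⟩⟩
  -- `α² + β² Q` is the determinant of `α + β B`, which is invertible.
  · have hdet : (T E 1).det ≠ 0 := fun h0 => by
      have := congrArg Matrix.det ((hT E).left_mul_right 1 h01)
      simp [h0] at this
    rw [hTeq, Matrix.det_fin_two] at hdet
    simp [hB, productMatrix] at hdet
    intro h0
    apply hdet
    rw [← h0, h.integral_eq E ε hεU]
    ring
  · obtain ⟨β', hβ'⟩ : ∃ β', HasDerivAt β β' E := ⟨_, (hβd E).hasDerivAt⟩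
    obtain ⟨a, ha⟩ : ∃ a, HasDerivAt (Ξ₀ ε) a E := ⟨_, (hd0 E).hasDerivAt⟩
    obtain ⟨b, hb⟩ : ∃ b, HasDerivAt (Ξ₁ ε) b E := ⟨_, (hd1 E).hasDerivAt⟩
    obtain ⟨c, hc⟩ : ∃ c, HasDerivAt (Ξ₂ ε) c E := ⟨_, (hd2 E).hasDerivAt⟩
    have hcb : HasDerivAt (fun E => Ξ₀ ε E * (u ε - E) - Ξ₂ ε E / 2)
        (a * (u ε - E) - Ξ₀ ε E - c / 2) E :=
      ((ha.fun_mul ((hasDerivAt_id E).const_sub (u ε))).sub (hc.div_const 2)).congr_deriv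
        (by simp; ring)
    have hQ : HasDerivAt Q (-(Ξ₁ ε E / 2 * b + a * (Ξ₀ ε E * (u ε - E) - Ξ₂ ε E / 2)
        + Ξ₀ ε E * (a * (u ε - E) - Ξ₀ ε E - c / 2))) E := by
      have : HasDerivAt (fun E => -(Ξ₁ ε E * Ξ₁ ε E / 4
          + Ξ₀ ε E * (Ξ₀ ε E * (u ε - E) - Ξ₂ ε E / 2))) (-(Ξ₁ ε E / 2 * b +
            a * (Ξ₀ ε E * (u ε - E) - Ξ₂ ε E / 2)
            + Ξ₀ ε E * (a * (u ε - E) - Ξ₀ ε E - c / 2))) E :=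
        ((((hb.fun_mul hb).div_const 4).add (ha.fun_mul hcb)).neg).congr_deriv (by ring)
      refine this.congr_of_eventuallyEq (Eventually.of_forall fun E => ?_)
      rw [h.integral_eq E ε hεU]
      ring
    refine ⟨β', _, hβ', hQ, ?_⟩
    -- differentiate `tr (T B) = -2 β Q` through the entries of `T`
    obtain ⟨M, hM⟩ : ∃ M, M = T E 1 * ∫ x in (0 : ℝ)..1, S E x * paramMatrix P * T E x := ⟨_, rfl⟩
    have hent' : ∀ i j, HasDerivAt (fun E => T E 1 i j) (M i j) E := fun i j => by
      have := (traceMul (Matrix.single j i 1)).hasFDerivAt.comp_hasDerivAt E (hTd E)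
      rw [← hM] at this
      refine (this.congr_deriv ?_).congr_of_eventuallyEq (Eventually.of_forall fun E => ?_)
      · exact (Matrix.trace_mul_single M j i 1).trans (mul_one _)
      · simp [Matrix.trace_mul_single]
    have e1 := ((hβ'.fun_mul hb.neg).congr_of_eventuallyEq
      (Eventually.of_forall fun E => (hβ1 E).symm)).unique ((hent' 0 0).sub (hent' 1 1))
    have e2 := ((hβ'.fun_mul ha).congr_of_eventuallyEq
      (Eventually.of_forall fun E => (hβ2 E).symm)).unique (hent' 0 1)
    have e3 := ((hβ'.fun_mul hcb).congr_of_eventuallyEq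
      (Eventually.of_forall fun E => (hβ3 E).symm)).unique (hent' 1 0)
    have t2 := htr2 E
    rw [← hM] at t2
    generalize (∫ t in (0 : ℝ)..1, Ξ₀ (ε + t * P) E * P) = I at t2 ⊢
    simp [hB, productMatrix, Matrix.trace, Fin.sum_univ_two, Matrix.mul_apply, -mul_eq_mul_left_iff]
      at t2
    rw [h.integral_eq E ε hεU]
    simp at e1
    linear_combination -t2 + Ξ₁ ε E / 2 * e1 - (Ξ₀ ε E * (u ε - E) - Ξ₂ ε E / 2) * e2 - Ξ₀ ε E * e3
  · intro f f' hf hf' s hs1 hs2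
    -- The Cauchy data form the first column of a square matrix, so that the result on `Y' = A Y` in
    -- the matrix ring applies.
    have hV : ∀ t ∈ Icc (0 : ℝ) 1, HasDerivAt
        (fun t : ℝ => (!![f (ε + t * P), 0; f' (ε + t * P), 0] : Matrix (Fin 2) (Fin 2) ℂ))
        ((segmentMatrix u ε P t + E • paramMatrix P) *
          !![f (ε + t * P), 0; f' (ε + t * P), 0]) t := by
      intro t ht
      rw [segmentMatrix_add E ht]
      have df := hasDerivAt_comp_segment (hf _ (hU t ht))
      have df' := hasDerivAt_comp_segment (hf' _ (hU t ht))
      refine hasDerivAt_matrix fun i j => ?_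
      fin_cases i <;> fin_cases j <;> simp [-mul_eq_mul_left_iff]
      · exact df
      · exact hasDerivAt_const _ _
      · exact df'.congr_deriv (by ring)
      · exact hasDerivAt_const _ _
    have key := (hT E).eq_left_mul hV 1 h01
    rw [hTeq] at key
    have k0 := congrFun (congrFun key 0) 0
    have k1 := congrFun (congrFun key 1) 0
    simp [hB, productMatrix, Matrix.mul_apply, Fin.sum_univ_two] at k0 k1
    constructor
    · rw [k0]; linear_combination β E * hs1
    · rw [k1]; linear_combination β E * hs2

end IsProductFamily

end MatrixMonodromy

end Inozemtsev

end

noncomputable section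

namespace Inozemtsev

open Set intervalIntegral

/-! ### The multiplier on the curve `ν² = -Q` and integration along paths -/

section Monodromy

/-- The multiplier `α(E) + β(E) ν` of a period on the curve `ν² = -Q(E)`, together with its
derivative `-(I(E) / 2ν) (α(E) + β(E) ν) dE`. -/
structure IsMonodromy (α β I Q : ℂ → ℂ) : Prop where
  norm_ne_zero : ∀ E, α E ^ 2 + β E ^ 2 * Q E ≠ 0
  hasDerivAt_left : ∀ E, HasDerivAt α (-(β E * I E) / 2) E
  hasDerivAt_right : ∀ E, ∃ β' Q', HasDerivAt β β' E ∧ HasDerivAt Q Q' E ∧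
    2 * Q E * β' + Q' * β E = α E * I E

/-- A continuous square root is differentiated without choosing a branch: divide the slope of `s²`
by `s x + s t`. -/
theorem hasDerivAt_of_sq {𝕜 : Type*} [NontriviallyNormedField 𝕜] [NormedAlgebra 𝕜 ℂ]
    {s : 𝕜 → ℂ} {d : ℂ} {t : 𝕜} (hs : ContinuousAt s t) (h0 : s t ≠ 0)
    (h : HasDerivAt (fun x => s x ^ 2) d t) : HasDerivAt s (d / (2 * s t)) t := by
  rw [hasDerivAt_iff_tendsto_slope] at h ⊢
  have hsum : Tendsto (fun x => s x + s t) (𝓝[≠] t) (𝓝 (2 * s t)) := by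
    rw [two_mul]
    exact (hs.tendsto.mono_left nhdsWithin_le_nhds).add tendsto_const_nhds
  have h2 : 2 * s t ≠ 0 := mul_ne_zero two_ne_zero h0
  refine (h.div hsum h2).congr' ?_
  filter_upwards [hsum.eventually_ne h2] with x hx
  simp only [Pi.div_apply, slope, vsub_eq_sub]
  rw [smul_div_assoc, sq_sub_sq, mul_div_cancel_left₀ _ hx]

namespace IsMonodromy

variable {α β I Q : ℂ → ℂ}

/-- The product of the conjugate multipliers `α ± β s` is `α² + β² Q`. -/
theorem multiplier_ne_zero (h : IsMonodromy α β I Q) {E s : ℂ} (hs : s ^ 2 = -Q E) :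
    α E + β E * s ≠ 0 := fun h0 => h.norm_ne_zero E <| by
  linear_combination (α E - β E * s) * h0 + β E ^ 2 * hs

/-- Combines `s' = -Q' e' / (2 s)` with the equations for `α` and `β`. The field `𝕜` is `ℝ` for
paths and `ℂ` for parametrizations of the curve. -/
theorem hasDerivAt_multiplier (h : IsMonodromy α β I Q) {𝕜 : Type*} [NontriviallyNormedField 𝕜]
    [NormedAlgebra 𝕜 ℂ] {e s : 𝕜 → ℂ} {e' : ℂ} {t : 𝕜} (he : HasDerivAt e e' t)
    (hs : ContinuousAt s t) (h0 : s t ≠ 0) (hsq : ∀ᶠ x in 𝓝 t, s x ^ 2 = -Q (e x)) :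
    HasDerivAt (fun x => α (e x) + β (e x) * s x)
      (-(1 / 2) * (I (e t) / s t * e') * (α (e t) + β (e t) * s t)) t := by
  obtain ⟨β', Q', hβ, hQ, hrel⟩ := h.hasDerivAt_right (e t)
  have hα := (h.hasDerivAt_left (e t)).scomp t he
  have hβ := hβ.scomp t he
  have hs' := hasDerivAt_of_sq hs h0 (((hQ.scomp t he).neg).congr_of_eventuallyEq hsq)
  refine (hα.add (hβ.fun_mul hs')).congr_deriv ?_
  have hsq' : s t ^ 2 = -Q (e t) := hsq.self_of_nhds
  simp only [Function.comp_apply, smul_eq_mul]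
  field_simp
  linear_combination (-e') * hrel + 2 * e' * β' * hsq'

end IsMonodromy

/-- Near `a` the primitive of `f` differs by a constant from `c⁻¹ log (M / M a)`, which has a limit
at `a` because `M` is continuous and nonzero there. Nothing is assumed of `f` at the endpoints. -/
theorem exists_tendsto_integral_of_log {M f : ℝ → ℂ} {c : ℂ} (hc : c ≠ 0)
    (hM : ContinuousOn M (Icc 0 1)) (hM0 : ∀ t ∈ Icc (0 : ℝ) 1, M t ≠ 0)
    (hf : ContinuousOn f (Ioo 0 1)) (hd : ∀ t ∈ Ioo (0 : ℝ) 1, HasDerivAt M (c * f t * M t) t)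
    {m : ℝ} (hm : m ∈ Ioo (0 : ℝ) 1) {a : ℝ} (ha : a ∈ Icc (0 : ℝ) 1) :
    ∃ L, Tendsto (fun t => ∫ x in m..t, f x) (𝓝[Ioo 0 1] a) (𝓝 L) := by
  have hF : ∀ t ∈ Ioo (0 : ℝ) 1, HasDerivAt (fun t => ∫ x in m..t, f x) (f t) t := fun t ht => by
    refine integral_hasDerivAt_right ?_ ?_ (hf.continuousAt (Ioo_mem_nhds ht.1 ht.2))
    · refine (hf.mono fun x hx => ?_).intervalIntegrable
      exact OrdConnected.uIcc_subset ordConnected_Ioo hm ht hx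
    · exact hf.stronglyMeasurableAtFilter isOpen_Ioo t ht
  have hlim : Tendsto (fun t => M t / M a) (𝓝[Icc 0 1] a) (𝓝 1) := by
    have := (hM a ha).tendsto.div_const (M a)
    rwa [div_self (hM0 a ha)] at this
  have hslit : ∀ᶠ t in 𝓝[Icc 0 1] a, M t / M a ∈ Complex.slitPlane :=
    hlim.eventually (Complex.isOpen_slitPlane.mem_nhds Complex.one_mem_slitPlane)
  obtain ⟨δ, hδ, hball⟩ := Metric.mem_nhdsWithin_iff.1 hslit
  set W : Set ℝ := Metric.ball a δ ∩ Ioo 0 1 with hW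
  have hWo : IsOpen W := Metric.isOpen_ball.inter isOpen_Ioo
  have hWc : IsPreconnected W := ((convex_ball a δ).inter (convex_Ioo 0 1)).isPreconnected
  have hG : ∀ t ∈ W, HasDerivAt (fun t => c⁻¹ * Complex.log (M t / M a)) (f t) t := fun t ht => by
    have hs : M t / M a ∈ Complex.slitPlane := hball ⟨ht.1, Ioo_subset_Icc_self ht.2⟩
    refine ((((hd t ht.2).div_const (M a)).clog_real hs).const_mul c⁻¹).congr_deriv ?_
    have h1 := hM0 a ha
    have h2 := hM0 t (Ioo_subset_Icc_self ht.2)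
    field_simp
  obtain ⟨k, hk⟩ := hWo.exists_eq_add_of_deriv_eq (𝕜 := ℝ) hWc
    (fun t ht => (hF t ht.2).differentiableAt.differentiableWithinAt)
    (fun t ht => (hG t ht).differentiableAt.differentiableWithinAt)
    (fun t ht => by rw [(hF t ht.2).deriv, (hG t ht).deriv])
  have hlog : Tendsto (fun t => c⁻¹ * Complex.log (M t / M a) + k) (𝓝[Ioo 0 1] a)
      (𝓝 (c⁻¹ * Complex.log 1 + k)) :=
    (((continuousAt_clog Complex.one_mem_slitPlane).tendsto.comp
      (hlim.mono_left (nhdsWithin_mono a Ioo_subset_Icc_self))).const_mul c⁻¹).add_const k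
  refine ⟨_, hlog.congr' ?_⟩
  filter_upwards [inter_mem_nhdsWithin (Ioo (0 : ℝ) 1) (Metric.ball_mem_nhds a hδ)] with t ht
  exact (hk ⟨ht.2, ht.1⟩).symm

/-- The logarithm of a nonvanishing function that is continuous on `[0,1]`, as an improper
integral of its logarithmic derivative on `(0,1)`. -/
theorem exists_tendsto_integral_logDeriv {M f : ℝ → ℂ} {c : ℂ} (hc : c ≠ 0)
    (hM : ContinuousOn M (Icc 0 1)) (hM0 : ∀ t ∈ Icc (0 : ℝ) 1, M t ≠ 0)
    (hf : ContinuousOn f (Ioo 0 1)) (hd : ∀ t ∈ Ioo (0 : ℝ) 1, HasDerivAt M (c * f t * M t) t) :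
    ∃ J, Tendsto (fun p : ℝ × ℝ => ∫ t in p.1..p.2, f t)
        (𝓝[>] (0 : ℝ) ×ˢ 𝓝[<] (1 : ℝ)) (𝓝 J) ∧ M 1 = M 0 * Complex.exp (c * J) := by
  have hm : (1 / 2 : ℝ) ∈ Ioo (0 : ℝ) 1 := by norm_num
  have hii : ∀ a ∈ Ioo (0 : ℝ) 1, ∀ b ∈ Ioo (0 : ℝ) 1,
      IntervalIntegrable f MeasureTheory.volume a b := fun a ha b hb =>
    (hf.mono (OrdConnected.uIcc_subset ordConnected_Ioo ha hb)).intervalIntegrable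
  obtain ⟨L₀, h₀⟩ := exists_tendsto_integral_of_log hc hM hM0 hf hd hm (a := 0) (by simp)
  obtain ⟨L₁, h₁⟩ := exists_tendsto_integral_of_log hc hM hM0 hf hd hm (a := 1) (by simp)
  have c0 := (hM 0 (by simp)).mono Ioo_subset_Icc_self
  have c1 := (hM 1 (by simp)).mono Ioo_subset_Icc_self
  rw [ContinuousWithinAt] at c0 c1
  rw [nhdsWithin_Ioo_eq_nhdsGT zero_lt_one] at h₀ c0
  rw [nhdsWithin_Ioo_eq_nhdsLT zero_lt_one] at h₁ c1
  have hmem : ∀ᶠ p : ℝ × ℝ in 𝓝[>] (0 : ℝ) ×ˢ 𝓝[<] (1 : ℝ),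
      p.1 ∈ Ioo (0 : ℝ) 1 ∧ p.2 ∈ Ioo (0 : ℝ) 1 :=
    prod_mem_prod (Ioo_mem_nhdsGT zero_lt_one) (Ioo_mem_nhdsLT zero_lt_one)
  have hJ : Tendsto (fun p : ℝ × ℝ => ∫ t in p.1..p.2, f t)
      (𝓝[>] (0 : ℝ) ×ˢ 𝓝[<] (1 : ℝ)) (𝓝 (L₁ - L₀)) := by
    refine ((h₁.comp tendsto_snd).sub (h₀.comp tendsto_fst)).congr' ?_
    filter_upwards [hmem] with p hp
    exact integral_interval_sub_left (hii _ hm _ hp.2) (hii _ hm _ hp.1)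
  refine ⟨L₁ - L₀, hJ, ?_⟩
  refine tendsto_nhds_unique (c1.comp tendsto_snd)
    (((c0.comp tendsto_fst).mul (Complex.continuous_exp.tendsto _ |>.comp
      (hJ.const_mul c))).congr' ?_)
  filter_upwards [hmem] with p hp
  simp only [Function.comp_apply]
  have hF : ∀ t ∈ Ioo (0 : ℝ) 1,
      HasDerivAt (fun t => M t * Complex.exp (-(c * ∫ x in p.1..t, f x))) 0 t := fun t ht => by
    have hI : HasDerivAt (fun t => ∫ x in p.1..t, f x) (f t) t :=
      integral_hasDerivAt_right (hii _ hp.1 _ ht) (hf.stronglyMeasurableAtFilter isOpen_Ioo t ht)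
        (hf.continuousAt (Ioo_mem_nhds ht.1 ht.2))
    refine ((hd t ht).fun_mul (hI.const_mul c).neg.cexp).congr_deriv ?_
    ring
  have := isOpen_Ioo.is_const_of_deriv_eq_zero (𝕜 := ℝ) isPreconnected_Ioo
    (fun t ht => (hF t ht).differentiableAt.differentiableWithinAt)
    (fun t ht => (hF t ht).deriv) hp.2 hp.1
  simp only [integral_same, mul_zero, neg_zero, Complex.exp_zero, mul_one] at this
  rw [← this, mul_assoc, ← Complex.exp_add, neg_add_cancel, Complex.exp_zero, mul_one]

/-- The multiplier is continuous and nonzero on the closed path, even where `s` vanishes at an end;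
its logarithmic derivative is the integrand up to the factor `-1/2`. -/
theorem IsMonodromy.exists_hasPathIntegral {α β I : ℂ → ℂ} {Q : ℂ[X]}
    (h : IsMonodromy α β I fun E => Q.eval E) (hI : Continuous I) {E₀ s₀ E₁ s₁ : ℂ} {γ s : ℝ → ℂ}
    (hγ : IsBranchPath Q E₀ s₀ E₁ s₁ γ s) :
    ∃ J, HasPathIntegral I γ s J ∧
      α E₁ + β E₁ * s₁ = (α E₀ + β E₀ * s₀) * Complex.exp (-(1 / 2) * J) := by
  have hα : Continuous α := continuous_iff_continuousAt.2 fun E =>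
    (h.hasDerivAt_left E).continuousAt
  have hβ : Continuous β := continuous_iff_continuousAt.2 fun E => by
    obtain ⟨β', -, hβ, -⟩ := h.hasDerivAt_right E
    exact hβ.continuousAt
  have hs0 : ∀ t ∈ Ioo (0 : ℝ) 1, s t ≠ 0 := fun t ht h0 => hγ.ne_zero t ht <| by
    have := hγ.sq_root t (Ioo_subset_Icc_self ht)
    rw [h0] at this
    simpa using this.symm
  have hd : ∀ t ∈ Ioo (0 : ℝ) 1, HasDerivAt γ (deriv γ t) t := fun t ht =>
    ((hγ.contDiffOn.differentiableOn one_ne_zero).differentiableAt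
      (Ioo_mem_nhds ht.1 ht.2)).hasDerivAt
  obtain ⟨J, hJ, hM⟩ := exists_tendsto_integral_logDeriv
    (M := fun t => α (γ t) + β (γ t) * s t) (f := fun t => I (γ t) / s t * deriv γ t)
    (c := -(1 / 2)) (by norm_num)
    ((hα.comp_continuousOn hγ.continuousOn).add
      ((hβ.comp_continuousOn hγ.continuousOn).mul hγ.continuousOn_root))
    (fun t ht => h.multiplier_ne_zero (hγ.sq_root t ht))
    (((hI.comp_continuousOn (hγ.continuousOn.mono Ioo_subset_Icc_self)).div
      (hγ.continuousOn_root.mono Ioo_subset_Icc_self) hs0).mul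
      (hγ.contDiffOn.continuousOn_deriv_of_isOpen isOpen_Ioo le_rfl))
    (fun t ht => h.hasDerivAt_multiplier (hd t ht)
      (hγ.continuousOn_root.continuousAt (Icc_mem_nhds ht.1 ht.2)) (hs0 t ht)
      (by filter_upwards [Icc_mem_nhds ht.1 ht.2] with x hx using hγ.sq_root x hx))
  refine ⟨J, hJ, ?_⟩
  simpa only [hγ.source.1, hγ.source.2, hγ.target.1, hγ.target.2] using hM

end Monodromy

end Inozemtsev

end

noncomputable section

namespace Inozemtsev

open Set

/-! ### Differentials of the second kind -/

section SecondKind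

theorem exists_analyticAt_primitive {f : ℂ → ℂ} {z : ℂ} (hf : AnalyticAt ℂ f z) :
    ∃ F : ℂ → ℂ, AnalyticAt ℂ F z ∧ ∀ᶠ w in 𝓝 z, HasDerivAt F (f w) w := by
  obtain ⟨r, hr, hball⟩ := Metric.eventually_nhds_iff_ball.1 hf.eventually_analyticAt
  have hd : DifferentiableOn ℂ f (Metric.ball z r) := fun w hw =>
    (hball w hw).differentiableAt.differentiableWithinAt
  obtain ⟨F, hF⟩ := hd.isExactOn_ball
  have hnhds : Metric.ball z r ∈ 𝓝 z := Metric.ball_mem_nhds z hr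
  refine ⟨F, ?_, by filter_upwards [hnhds] with w hw using hF w hw⟩
  exact DifferentiableOn.analyticAt (s := Metric.ball z r)
    (fun w hw => (hF w hw).differentiableAt.differentiableWithinAt) hnhds

theorem exists_analyticAt_sqrt {f : ℂ → ℂ} (hf : AnalyticAt ℂ f 0) (h0 : f 0 = 1) :
    ∃ h : ℂ → ℂ, AnalyticAt ℂ h 0 ∧ h 0 ≠ 0 ∧ ∀ᶠ w in 𝓝 0, h w ^ 2 = -f w := by
  refine ⟨fun w => Complex.I * Complex.exp (Complex.log (f w) / 2), ?_, by simp, ?_⟩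
  · have : AnalyticAt ℂ (fun w => Complex.log (f w)) 0 :=
      hf.clog (by rw [h0]; exact Complex.one_mem_slitPlane)
    fun_prop
  · filter_upwards [hf.continuousAt.eventually_ne (by rw [h0]; exact one_ne_zero)] with w hw
    rw [mul_pow, Complex.I_sq, ← Complex.exp_nat_mul]
    push_cast
    rw [mul_div_cancel₀ _ two_ne_zero, Complex.exp_log hw]
    ring

theorem eval_eq_reverse_mul_pow (p : ℂ[X]) {x : ℂ} (hx : x ≠ 0) :
    p.eval x = p.reverse.eval x⁻¹ * x ^ p.natDegree := by
  let := invertibleOfNonzero hx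
  have := eval₂_reverse_mul_pow (RingHom.id ℂ) x p
  rw [invOf_eq_inv] at this
  exact this.symm

theorem eventually_eventually_of_nhdsNE {p : ℂ → Prop} {z : ℂ} (h : ∀ᶠ t in 𝓝[≠] z, p t) :
    ∀ᶠ t in 𝓝[≠] z, ∀ᶠ x in 𝓝 t, p x := by
  have h2 := eventually_eventually_nhdsWithin.2 h
  filter_upwards [h2, self_mem_nhdsWithin] with t ht htz
  rwa [(isOpen_compl_singleton.nhdsWithin_eq htz)] at ht

/-- The part of the second kind property concerning the finite points of the curve. -/
theorem exists_primitive_of_meromorphicOrderAt_nonneg {α β : ℂ → ℂ} {Q N : ℂ[X]}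
    (h : IsMonodromy α β (fun E => N.eval E) fun E => Q.eval E) {e ν : ℂ → ℂ}
    (he : MeromorphicAt e 0) (hν : MeromorphicAt ν 0)
    (hsq : ∀ᶠ t in 𝓝[≠] (0 : ℂ), ν t ^ 2 = -Q.eval (e t))
    (hν0 : ∀ᶠ t in 𝓝[≠] (0 : ℂ), ν t ≠ 0) (hord : 0 ≤ meromorphicOrderAt e 0) :
    ∃ F : ℂ → ℂ, MeromorphicAt F 0 ∧
      ∀ᶠ t in 𝓝[≠] (0 : ℂ), HasDerivAt F (N.eval (e t) / ν t * deriv e t) t := by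
  obtain ⟨e₁, he₁, hee⟩ := he.meromorphicOrderAt_nonneg_iff.1 hord
  -- A pole of `ν` would make `ν²` unbounded, while `-Q(e)` stays bounded.
  have hordν : 0 ≤ meromorphicOrderAt ν 0 := by
    by_contra hneg
    have hcob := tendsto_norm_atTop_iff_cobounded.2
      (tendsto_cobounded_of_meromorphicOrderAt_neg (not_le.1 hneg))
    have hcont : Tendsto (fun t => ‖-Q.eval (e₁ t)‖) (𝓝[≠] 0) (𝓝 ‖-Q.eval (e₁ 0)‖) :=
      ((Q.continuous.continuousAt.comp he₁.continuousAt).neg.norm.tendsto).mono_left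
        nhdsWithin_le_nhds
    refine not_tendsto_atTop_of_tendsto_nhds hcont
      (((tendsto_pow_atTop two_ne_zero).comp hcob).congr' ?_)
    filter_upwards [hsq, hee] with t ht hte
    rw [← hte, ← ht, Function.comp_apply, norm_pow]
  obtain ⟨ν₁, hν₁, hνν⟩ := hν.meromorphicOrderAt_nonneg_iff.1 hordν
  have hαd : Differentiable ℂ α := fun E => (h.hasDerivAt_left E).differentiableAt
  have hβd : Differentiable ℂ β := fun E => by
    obtain ⟨β', -, hβ, -⟩ := h.hasDerivAt_right E
    exact hβ.differentiableAt
  set M : ℂ → ℂ := fun t => α (e₁ t) + β (e₁ t) * ν₁ t with hM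
  have hMa : AnalyticAt ℂ M 0 :=
    ((hαd.analyticAt _).comp he₁).add (((hβd.analyticAt _).comp he₁).mul hν₁)
  have hsq0 : ν₁ 0 ^ 2 = -Q.eval (e₁ 0) := by
    have hc : ContinuousAt (fun t => -Q.eval (e₁ t)) 0 :=
      (Q.continuous.continuousAt.comp he₁.continuousAt).neg
    have : (fun t => ν₁ t ^ 2) =ᶠ[𝓝[≠] 0] fun t => -Q.eval (e₁ t) := by
      filter_upwards [hsq, hee, hνν] with t h1 h2 h3
      rw [← h2, ← h3, h1]
    exact (((hν₁.continuousAt.pow 2).eventuallyEq_nhds_iff_eventuallyEq_nhdsNE hc).1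
      this).eq_of_nhds
  have hM0 : M 0 ≠ 0 := h.multiplier_ne_zero hsq0
  have hslit : M 0 / M 0 ∈ Complex.slitPlane := by
    rw [div_self hM0]
    exact Complex.one_mem_slitPlane
  have hMa' : AnalyticAt ℂ (fun t => M t / M 0) 0 := hMa.div_const
  -- The logarithmic differential of `M` is `-(1/2)` times the given one; dividing by `M 0` keeps
  -- the argument near `1`, inside the domain of the principal logarithm. This also covers the
  -- branch points.
  refine ⟨fun t => -2 * Complex.log (M t / M 0),
    (analyticAt_const.mul (hMa'.clog hslit)).meromorphicAt, ?_⟩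
  have hev : ∀ᶠ t in 𝓝 (0 : ℂ), M t / M 0 ∈ Complex.slitPlane :=
    hMa'.continuousAt.eventually (Complex.isOpen_slitPlane.mem_nhds hslit)
  have hev0 : ∀ᶠ t in 𝓝 (0 : ℂ), M t ≠ 0 := hMa.continuousAt.eventually_ne hM0
  filter_upwards [eventually_eventually_of_nhdsNE hee, eventually_eventually_of_nhdsNE hνν, hν0,
    nhdsWithin_le_nhds hev, nhdsWithin_le_nhds hev0,
    nhdsWithin_le_nhds he₁.eventually_analyticAt, nhdsWithin_le_nhds hν₁.eventually_analyticAt,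
    eventually_eventually_of_nhdsNE hsq] with t h1 h2 h3 h4 h5 h6 h7 h8
  have h2' : ν =ᶠ[𝓝 t] ν₁ := h2
  have h3' : ν₁ t ≠ 0 := by rwa [← h2'.eq_of_nhds]
  have hd := h.hasDerivAt_multiplier h6.differentiableAt.hasDerivAt h7.continuousAt h3' (by
    filter_upwards [h1, h2, h8] with x h1 h2 h8
    rw [← h1, ← h2]
    exact h8)
  refine (((hd.div_const (M 0)).clog h4).const_mul (-2)).congr_deriv ?_
  have h1' : e =ᶠ[𝓝 t] e₁ := h1
  rw [h1'.eq_of_nhds, h2'.eq_of_nhds, h1'.deriv_eq]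
  change -2 * (-(1 / 2) * (N.eval (e₁ t) / ν₁ t * deriv e₁ t) * M t / M 0 / (M t / M 0)) = _
  field_simp

/-- The part of the second kind property concerning the point at infinity of the curve. -/
theorem exists_primitive_of_meromorphicOrderAt_neg {Q N : ℂ[X]} {g : ℕ} (hQ : Q.Monic)
    (hQd : Q.natDegree = 2 * g + 1) (hN : N.natDegree = g) {e ν : ℂ → ℂ}
    (he : MeromorphicAt e 0) (hν : MeromorphicAt ν 0)
    (hsq : ∀ᶠ t in 𝓝[≠] (0 : ℂ), ν t ^ 2 = -Q.eval (e t))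
    (hν0 : ∀ᶠ t in 𝓝[≠] (0 : ℂ), ν t ≠ 0) (hord : meromorphicOrderAt e 0 < 0) :
    ∃ F : ℂ → ℂ, MeromorphicAt F 0 ∧
      ∀ᶠ t in 𝓝[≠] (0 : ℂ), HasDerivAt F (N.eval (e t) / ν t * deriv e t) t := by
  have hcob := tendsto_cobounded_of_meromorphicOrderAt_neg hord
  have he0 : ∀ᶠ t in 𝓝[≠] (0 : ℂ), e t ≠ 0 := hcob.eventually_ne_cobounded 0
  have hinv : Tendsto (fun t => (e t)⁻¹) (𝓝[≠] 0) (𝓝 0) := tendsto_inv₀_cobounded.comp hcob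
  obtain ⟨w, hw, hew⟩ := he.inv.meromorphicOrderAt_nonneg_iff.1
    ((tendsto_nhds_iff_meromorphicOrderAt_nonneg he.inv).1 ⟨0, hinv⟩)
  have hw0 : w 0 = 0 := tendsto_nhds_unique
    (hw.continuousAt.tendsto.mono_left nhdsWithin_le_nhds) (hinv.congr' hew)
  obtain ⟨h, hh, hh0, hhsq⟩ := exists_analyticAt_sqrt (f := fun w => Q.reverse.eval w)
    (Differentiable.analyticAt (Polynomial.differentiable _) 0) (by
      rw [← coeff_zero_eq_eval_zero, coeff_zero_reverse, hQ.leadingCoeff])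
  have hhw : AnalyticAt ℂ (fun t => h (w t)) 0 := AnalyticAt.comp (by rwa [hw0]) hw
  -- the local parameter `z = E ^ (-1 / 2)`
  have hz : MeromorphicAt (fun t => e t ^ g * h (w t) / ν t) 0 :=
    ((he.pow g).mul hhw.meromorphicAt).div hν
  have hwt : Tendsto w (𝓝[≠] 0) (𝓝 0) := hinv.congr' hew
  have hzsq : ∀ᶠ t in 𝓝[≠] (0 : ℂ), (e t ^ g * h (w t) / ν t) ^ 2 = w t := by
    filter_upwards [hsq, hν0, he0, hew, hwt.eventually hhsq] with t h1 h2 h3 h4 h5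
    have h4' : (e t)⁻¹ = w t := h4
    have hQe : Q.eval (e t) ≠ 0 := fun hq => by
      rw [hq, neg_zero] at h1
      exact h2 (pow_eq_zero_iff two_ne_zero |>.1 h1)
    have hr := eval_eq_reverse_mul_pow Q h3
    rw [hQd, h4'] at hr
    rw [div_pow, mul_pow, h5, h1, div_eq_iff (neg_ne_zero.2 hQe), hr, ← h4']
    field_simp
    ring
  have hztend : Tendsto (fun t => e t ^ g * h (w t) / ν t) (𝓝[≠] 0) (𝓝 0) := by
    have h0 := (hwt.congr' (EventuallyEq.symm hzsq)).norm
    rw [norm_zero] at h0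
    have h1 := (Real.continuous_sqrt.tendsto 0).comp h0
    rw [Real.sqrt_zero] at h1
    refine tendsto_zero_iff_norm_tendsto_zero.2 (h1.congr fun t => ?_)
    rw [Function.comp_apply, norm_pow, Real.sqrt_sq (norm_nonneg _)]
  obtain ⟨z, hza, hzz⟩ := hz.meromorphicOrderAt_nonneg_iff.1
    ((tendsto_nhds_iff_meromorphicOrderAt_nonneg hz).1 ⟨0, hztend⟩)
  have hz0 : z 0 = 0 := tendsto_nhds_unique
    (hza.continuousAt.tendsto.mono_left nhdsWithin_le_nhds) (hztend.congr' hzz)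
  -- the differential is `κ(z²) dz / z²`
  have hκ : AnalyticAt ℂ (fun w => -2 * N.reverse.eval w / h w) 0 :=
    (analyticAt_const.mul (Differentiable.analyticAt (Polynomial.differentiable _) 0)).div hh hh0
  set κ : ℂ → ℂ := fun w => -2 * N.reverse.eval w / h w with hκdef
  obtain ⟨p, hp⟩ := hκ
  have hκ₁ : AnalyticAt ℂ (dslope κ 0) 0 := ⟨_, hp.has_fpower_series_dslope_fslope⟩
  have hκ₂ : AnalyticAt ℂ (fun z : ℂ => dslope κ 0 (z ^ 2)) 0 :=
    AnalyticAt.comp (f := fun z : ℂ => z ^ 2)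
      (by rw [zero_pow two_ne_zero]; exact hκ₁) (by fun_prop)
  obtain ⟨K, hK, hKd⟩ := exists_analyticAt_primitive hκ₂
  -- Since `κ(z²) / z² = κ(0) / z² + dslope κ 0 (z²)`, no `1 / z` term occurs and no logarithm is
  -- needed.
  refine ⟨fun t => -κ 0 * (z t)⁻¹ + K (z t), ?_, ?_⟩
  · exact (MeromorphicAt.const _ _ |>.mul hza.meromorphicAt.inv).add
      (AnalyticAt.comp (by rwa [hz0]) hza).meromorphicAt
  have hzt : Tendsto z (𝓝[≠] 0) (𝓝 0) := hztend.congr' hzz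
  have hhne : ∀ᶠ w in 𝓝 (0 : ℂ), h w ≠ 0 := hh.continuousAt.eventually_ne hh0
  have hez : ∀ᶠ t in 𝓝[≠] (0 : ℂ), (e t)⁻¹ = z t ^ 2 := by
    filter_upwards [hew, hzsq, hzz] with t h1 h2 h3
    rw [← h3, h2, ← h1, Pi.inv_apply]
  filter_upwards [hν0, he0, hew, hwt.eventually hhne, hzz, hzt.eventually hKd,
    eventually_eventually_of_nhdsNE hez, nhdsWithin_le_nhds hza.eventually_analyticAt]
    with t hνt het hewt hht hzt hKt hezt hzat
  have hzz' : z t ^ 2 ≠ 0 := hezt.self_of_nhds ▸ inv_ne_zero het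
  have hz0' : z t ≠ 0 := fun h0 => hzz' (by rw [h0]; simp)
  have hwz : w t = z t ^ 2 := by rw [← hezt.self_of_nhds]; exact hewt.symm
  have hde : HasDerivAt e (-(2 * z t * deriv z t) / (z t ^ 2) ^ 2) t := by
    have := (hzat.differentiableAt.hasDerivAt.fun_pow 2).fun_inv hzz'
    refine (this.congr_deriv (by simp)).congr_of_eventuallyEq ?_
    filter_upwards [hezt] with x hx
    rw [← hx, inv_inv]
  have hF := ((hzat.differentiableAt.hasDerivAt.fun_inv hz0').const_mul (-κ 0)).add
    (hKt.comp t hzat.differentiableAt.hasDerivAt)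
  refine hF.congr_deriv ?_
  rw [hde.deriv, dslope_of_ne _ hzz', slope_def_field, sub_zero, eval_eq_reverse_mul_pow N het, hN,
    hezt.self_of_nhds]
  rw [hwz] at hzt hht
  have hκz : κ (z t ^ 2) = -2 * N.reverse.eval (z t ^ 2) / h (z t ^ 2) := rfl
  have hzt' : e t ^ g = z t * ν t / h (z t ^ 2) := by
    rw [eq_div_iff hht, ← div_eq_iff hνt]
    exact hzt
  rw [hκz, hzt']
  field_simp
  ring

theorem isSecondKind_of_isMonodromy {α β : ℂ → ℂ} {Q N : ℂ[X]} {g : ℕ} (hQ : Q.Monic)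
    (hQd : Q.natDegree = 2 * g + 1) (hN : N.natDegree = g)
    (h : IsMonodromy α β (fun E => N.eval E) fun E => Q.eval E) : IsSecondKind Q N := by
  intro e ν he hν hsq
  rcases hν.eventually_eq_zero_or_eventually_ne_zero with h0 | h0
  -- When `ν` vanishes identically, division by zero makes the differential zero.
  · refine ⟨fun _ => 0, MeromorphicAt.const 0 0, ?_⟩
    filter_upwards [h0] with t ht
    simpa [ht] using hasDerivAt_const t (0 : ℂ)
  · rcases lt_or_ge (meromorphicOrderAt e 0) 0 with ho | ho
    · exact exists_primitive_of_meromorphicOrderAt_neg hQ hQd hN he hν hsq h0 ho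
    · exact exists_primitive_of_meromorphicOrderAt_nonneg h he hν hsq h0 ho

end SecondKind

end Inozemtsev

end

noncomputable section

namespace Inozemtsev

open Set

/-! ### `Λ` as a solution of `f'' = (u - E) f` -/

section EigenFunction

/-- The indicial equation: if the order `n` is neither `0` nor `1`, then `f''` has order `n - 2`,
whereas `q f` has order at least `n`. -/
theorem meromorphicOrderAt_of_deriv_deriv {f q : ℂ → ℂ} {x : ℂ} (hf : MeromorphicAt f x)
    (hq : AnalyticAt ℂ q x) (h : deriv (deriv f) =ᶠ[𝓝[≠] x] q * f)
    (ht : meromorphicOrderAt f x ≠ ⊤) : meromorphicOrderAt f x = 0 ∨ meromorphicOrderAt f x = 1 := by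
  obtain ⟨n, hn⟩ := WithTop.ne_top_iff_exists.1 ht
  by_contra! hne
  have h0 : n ≠ 0 := fun h0 => hne.1 (by rw [← hn, h0]; rfl)
  have h1 : n - 1 ≠ 0 := fun h1 => hne.2 (by rw [← hn, sub_eq_zero.1 h1]; rfl)
  have hd := meromorphicOrderAt_deriv_eq_sub_one (by exact_mod_cast h0) hn.symm
  have hdd := meromorphicOrderAt_deriv_eq_sub_one (by exact_mod_cast h1) hd
  rw [meromorphicOrderAt_congr h, meromorphicOrderAt_mul hq.meromorphicAt hf, ← hn] at hdd
  have := hq.meromorphicOrderAt_nonneg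
  have h2 : (n : WithTop ℤ) ≤ meromorphicOrderAt q x + n := le_add_of_nonneg_left this
  rw [hdd] at h2
  have := WithTop.coe_le_coe.1 h2
  omega

/-- Uniqueness for the Cauchy problem: a solution that is not locally zero has order `0` or `1`, so
`f` and `f'` cannot both vanish. -/
theorem eventually_eq_zero_of_deriv_deriv {f q : ℂ → ℂ} {x : ℂ} (hf : AnalyticAt ℂ f x)
    (hq : AnalyticAt ℂ q x) (h : deriv (deriv f) =ᶠ[𝓝[≠] x] q * f) (h0 : f x = 0)
    (h1 : deriv f x = 0) : ∀ᶠ y in 𝓝 x, f y = 0 := by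
  by_cases ht : meromorphicOrderAt f x = ⊤
  · exact (hf.continuousAt.eventuallyEq_nhds_iff_eventuallyEq_nhdsNE continuousAt_const).1
      (meromorphicOrderAt_eq_top_iff.1 ht)
  · exfalso
    rcases meromorphicOrderAt_of_deriv_deriv hf.meromorphicAt hq h ht with ho | ho
    · exact hf.meromorphicNFAt.meromorphicOrderAt_eq_zero_iff.1 ho h0
    · have := meromorphicOrderAt_deriv_eq_sub_one (n := 1) (by norm_num) ho
      exact hf.deriv.meromorphicNFAt.meromorphicOrderAt_eq_zero_iff.1 (by simpa using this) h1

/-- Near each point of `U` where `X` does not vanish, `f` is the product of a branch of `√X` and of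
the exponential of a primitive of `s / X`. -/
def IsSqrtMulExp (U : Set ℂ) (X : ℂ → ℂ) (s : ℂ) (f : ℂ → ℂ) : Prop :=
  ∀ x ∈ U, X x ≠ 0 → ∃ r I : ℂ → ℂ, AnalyticAt ℂ r x ∧ ∀ᶠ y in 𝓝 x,
    r y ^ 2 = X y ∧ HasDerivAt I (s / X y) y ∧ f y = r y * Complex.exp (I y)

variable {U : Set ℂ} {u u' : ℂ → ℂ} {ε P : ℂ} {Ξ₀ Ξ₁ Ξ₂ : ℂ → ℂ → ℂ} {Q : ℂ → ℂ}
  {E s : ℂ} {f : ℂ → ℂ}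

theorem IsSqrtMulExp.ne_zero {X : ℂ → ℂ} (h : IsSqrtMulExp U X s f) {x : ℂ}
    (hx : x ∈ U) (h0 : X x ≠ 0) : f x ≠ 0 := by
  obtain ⟨r, I, -, hev⟩ := h x hx h0
  obtain ⟨h1, -, h3⟩ := hev.self_of_nhds
  rw [h3]
  refine mul_ne_zero (fun hr => h0 ?_) (Complex.exp_ne_zero _)
  rw [← h1, hr]
  simp

/-- Logarithmic differentiation: `f' / f = X' / (2 X) + s / X`, independently of the branch of the
root. -/
theorem IsSqrtMulExp.hasDerivAt {X : ℂ → ℂ} (h : IsSqrtMulExp U X s f) {x X' : ℂ}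
    (hx : x ∈ U) (h0 : X x ≠ 0) (hX : HasDerivAt X X' x) :
    HasDerivAt f ((X' / 2 + s) * f x / X x) x := by
  obtain ⟨r, I, hr, hev⟩ := h x hx h0
  obtain ⟨h1, h2, h3⟩ := hev.self_of_nhds
  have hrd := hr.differentiableAt.hasDerivAt
  have hX' : X' = 2 * r x * deriv r x := by
    have := (hrd.fun_pow 2).congr_of_eventuallyEq (hev.mono fun y hy => hy.1.symm)
    simpa using hX.unique this
  refine ((hrd.fun_mul h2.cexp).congr_of_eventuallyEq
    (hev.mono fun y hy => hy.2.2)).congr_deriv ?_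
  rw [h3, hX', ← h1]
  have hr0 : r x ≠ 0 := fun h => h0 (by rw [← h1, h]; simp)
  field_simp

namespace IsProductFamily

/-- On the set where `Ξ` does not vanish, `√Ξ exp ∫ s/Ξ` solves `f'' = (u - E) f`. -/
theorem hasDerivAt_deriv (h : IsProductFamily U u u' Ξ₀ Ξ₁ Ξ₂ Q) (hUo : IsOpen U)
    (hs : s ^ 2 = -Q E) (hf : IsSqrtMulExp U (fun x => Ξ₀ x E) s f) {x : ℂ} (hx : x ∈ U)
    (h0 : Ξ₀ x E ≠ 0) : HasDerivAt (deriv f) ((u x - E) * f x) x := by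
  have hev : deriv f =ᶠ[𝓝 x] fun y => (Ξ₁ y E / 2 + s) * f y / Ξ₀ y E := by
    filter_upwards [hUo.mem_nhds hx,
      (h.hasDerivAt_zero E x hx).continuousAt.eventually_ne h0] with y hy hy0
    exact (hf.hasDerivAt hy hy0 (h.hasDerivAt_zero E y hy)).deriv
  have hd := ((((h.hasDerivAt_one E x hx).div_const 2).add_const s).fun_mul
    (hf.hasDerivAt hx h0 (h.hasDerivAt_zero E x hx))).fun_div (h.hasDerivAt_zero E x hx) h0
  refine (hd.congr_of_eventuallyEq hev).congr_deriv ?_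
  rw [h.integral_eq E x hx] at hs
  field_simp
  linear_combination 4 * f x * hs

theorem analyticAt_potential_sub (h : IsProductFamily U u u' Ξ₀ Ξ₁ Ξ₂ Q) (hUo : IsOpen U)
    (E : ℂ) {x : ℂ} (hx : x ∈ U) : AnalyticAt ℂ (fun x => u x - E) x :=
  DifferentiableOn.analyticAt (s := U) (fun y hy =>
    ((h.hasDerivAt_potential y hy).sub_const E).differentiableAt.differentiableWithinAt)
    (hUo.mem_nhds hx)

variable (h : IsProductFamily U u u' Ξ₀ Ξ₁ Ξ₂ Q) (hUo : IsOpen U)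
  (hne : ∀ x ∈ U, ∀ᶠ y in 𝓝[≠] x, Ξ₀ y E ≠ 0)
  (hs : s ^ 2 = -Q E) (hnf : MeromorphicNFOn f univ)
  (hf : IsSqrtMulExp U (fun x => Ξ₀ x E) s f)
include h hUo hne hs hf

theorem deriv_deriv_eventuallyEq {x : ℂ} (hx : x ∈ U) :
    deriv (deriv f) =ᶠ[𝓝[≠] x] (fun x => u x - E) * f := by
  filter_upwards [hne x hx, nhdsWithin_le_nhds (hUo.mem_nhds hx)] with y hy hyU
  exact (h.hasDerivAt_deriv hUo hs hf hyU hy).deriv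

include hnf

/-- At a zero of `Ξ` the local formula is not available, but the differential equation holds around
it, so the order is `0` or `1`; normal form then turns nonnegative order into analyticity. -/
theorem analyticAt_eigenfunction {x : ℂ} (hx : x ∈ U) : AnalyticAt ℂ f x := by
  rw [← (hnf (mem_univ x)).meromorphicOrderAt_nonneg_iff_analyticAt]
  have hm := (hnf (mem_univ x)).meromorphicAt
  rcases meromorphicOrderAt_of_deriv_deriv hm (h.analyticAt_potential_sub hUo E hx)
    (h.deriv_deriv_eventuallyEq hUo hne hs hf hx)
    ((meromorphicOrderAt_ne_top_iff_eventually_ne_zero hm).2 (by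
      filter_upwards [hne x hx, nhdsWithin_le_nhds (hUo.mem_nhds hx)] with y hy hyU
      exact hf.ne_zero hyU hy)) with ho | ho
  · rw [ho]
  · rw [ho]; exact zero_le_one

theorem deriv_deriv_eigenfunction {x : ℂ} (hx : x ∈ U) :
    HasDerivAt (deriv f) ((u x - E) * f x) x := by
  have ha := h.analyticAt_eigenfunction hUo hne hs hnf hf hx
  refine ha.deriv.differentiableAt.hasDerivAt.congr_deriv ?_
  exact ((ha.deriv.deriv.continuousAt.eventuallyEq_nhds_iff_eventuallyEq_nhdsNE
    ((h.analyticAt_potential_sub hUo E hx).mul ha).continuousAt).1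
    (h.deriv_deriv_eventuallyEq hUo hne hs hf hx)).eq_of_nhds

/-- The first component of the statement that `(f, f')` is an eigenvector of `B` with eigenvalue
`s`. It passes by continuity to the zeros of `Ξ`, one of which may be the base point. -/
theorem eigenfunction_relation {x : ℂ} (hx : x ∈ U) :
    Ξ₀ x E * deriv f x - Ξ₁ x E / 2 * f x = s * f x := by
  have ha := h.analyticAt_eigenfunction hUo hne hs hnf hf hx
  have c0 := (h.hasDerivAt_zero E x hx).continuousAt
  have c1 := (h.hasDerivAt_one E x hx).continuousAt
  have c2 := ha.continuousAt
  have c3 := ha.deriv.continuousAt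
  have key : (fun x => Ξ₀ x E * deriv f x - Ξ₁ x E / 2 * f x) =ᶠ[𝓝[≠] x] fun x => s * f x := by
    filter_upwards [hne x hx, nhdsWithin_le_nhds (hUo.mem_nhds hx)] with y hy hyU
    rw [(hf.hasDerivAt hyU hy (h.hasDerivAt_zero E y hyU)).deriv]
    field_simp
    ring
  exact ((ContinuousAt.eventuallyEq_nhds_iff_eventuallyEq_nhdsNE
    (by fun_prop) (by fun_prop)).1 key).eq_of_nhds

/-- The second component of the eigenvector relation, obtained by differentiating the first. -/
theorem eigenfunction_relation_deriv {x : ℂ} (hx : x ∈ U) :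
    (Ξ₀ x E * (u x - E) - Ξ₂ x E / 2) * f x + Ξ₁ x E / 2 * deriv f x = s * deriv f x := by
  have d1 := (h.analyticAt_eigenfunction hUo hne hs hnf hf hx).differentiableAt.hasDerivAt
  have d2 := h.deriv_deriv_eigenfunction hUo hne hs hnf hf hx
  have hL := ((h.hasDerivAt_zero E x hx).fun_mul d2).sub
    (((h.hasDerivAt_one E x hx).div_const 2).fun_mul d1)
  have hev : (fun x => Ξ₀ x E * deriv f x - Ξ₁ x E / 2 * f x) =ᶠ[𝓝 x] fun x => s * f x := by
    filter_upwards [hUo.mem_nhds hx] with y hy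
    exact h.eigenfunction_relation hUo hne hs hnf hf hy
  have := hL.unique ((d1.const_mul s).congr_of_eventuallyEq hev)
  linear_combination this

/-- If the translate by a period `P` of the solution `f` and of its derivative are the multiples
by `μ` at one point, then `f (x + P) = μ f x` everywhere. -/
theorem add_period_eq (hUc : IsPreconnected U) (hUd : ∀ x, ∀ᶠ y in 𝓝[≠] x, y ∈ U)
    (hUP : ∀ x ∈ U, x + P ∈ U) (huP : ∀ x ∈ U, u (x + P) = u x) (hε : ε ∈ U) {μ : ℂ} (hμ : μ ≠ 0)
    (h0 : f (ε + P) = μ * f ε) (h1 : deriv f (ε + P) = μ * deriv f ε) (x : ℂ) :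
    f (x + P) = μ * f x := by
  have ha : ∀ x ∈ U, AnalyticAt ℂ f x := fun x hx => h.analyticAt_eigenfunction hUo hne hs hnf hf hx
  have hd2 : ∀ x ∈ U, HasDerivAt (deriv f) ((u x - E) * f x) x := fun x hx =>
    h.deriv_deriv_eigenfunction hUo hne hs hnf hf hx
  set W : ℂ → ℂ := fun x => f (x + P) - μ * f x with hW
  have hWa : AnalyticOnNhd ℂ W U := fun x hx =>
    ((ha _ (hUP x hx)).comp (f := fun x => x + P) (by fun_prop)).sub
      (analyticAt_const.mul (ha x hx))
  have hWd : ∀ x ∈ U, deriv W x = deriv f (x + P) - μ * deriv f x := fun x hx =>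
    (((ha _ (hUP x hx)).differentiableAt.hasDerivAt.comp_add_const x P).sub
      ((ha x hx).differentiableAt.hasDerivAt.const_mul μ)).deriv
  have hWdd : ∀ x ∈ U, deriv (deriv W) x = (u x - E) * W x := fun x hx => by
    have hev : deriv W =ᶠ[𝓝 x] fun x => deriv f (x + P) - μ * deriv f x := by
      filter_upwards [hUo.mem_nhds hx] with y hy using hWd y hy
    rw [hev.deriv_eq, (((hd2 _ (hUP x hx)).comp_add_const x P).fun_sub
      ((hd2 x hx).const_mul μ)).deriv, huP x hx, hW]
    ring
  have hWz := hWa.eqOn_zero_of_preconnected_of_eventuallyEq_zero hUc hε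
    (eventually_eq_zero_of_deriv_deriv (hWa ε hε) (h.analyticAt_potential_sub hUo E hε)
      (by filter_upwards [nhdsWithin_le_nhds (hUo.mem_nhds hε)] with y hy using hWdd y hy)
      (by simp [hW, h0]) (by rw [hWd ε hε, h1, sub_self]))
  -- Both sides are in normal form, the right one because `μ ≠ 0`, so equality off the poles extends
  -- to the poles.
  have n1 : MeromorphicNFAt (fun x => f (x + P)) x :=
    meromorphicNFAt_comp_add_const_iff_meromorphicNFAt.2 (hnf (mem_univ (x + P)))
  have n2 : MeromorphicNFAt (fun x => μ * f x) x :=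
    (meromorphicNFAt_mul_iff_right (g := fun _ => μ) analyticAt_const hμ).2 (hnf (mem_univ x))
  exact ((MeromorphicNFAt.eventuallyEq_nhdsNE_iff_eventuallyEq_nhds n1 n2).1 (by
    filter_upwards [hUd x] with y hy using sub_eq_zero.1 (hWz hy))).eq_of_nhds

end IsProductFamily

end EigenFunction

end Inozemtsev

end

noncomputable section

namespace Inozemtsev

open Set

/-! ### The lattice and the poles of the potential -/

section Poles

variable (τ : UpperHalfPlane) (l : Fin 4 → ℕ)

theorem lattice_im {τ : UpperHalfPlane} {x : ℂ} (hx : x ∈ (periods τ).lattice) :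
    ∃ n : ℤ, x.im = n * τ.im := by
  obtain ⟨m, n, rfl⟩ := PeriodPair.mem_lattice.1 hx
  exact ⟨n, by simp [periods]⟩

theorem intCast_add_mul_mem_lattice (m n : ℤ) : (m : ℂ) + n * τ ∈ (periods τ).lattice :=
  PeriodPair.mem_lattice.2 ⟨m, n, by simp [periods]⟩

theorem halfPeriod_sub_notMem_lattice {i j : Fin 4} (hij : i ≠ j) :
    halfPeriod τ i - halfPeriod τ j ∉ (periods τ).lattice := by
  let α : Fin 4 → ℚ := ![0, 1 / 2, -(1 / 2), 0]
  let β : Fin 4 → ℚ := ![0, 0, -(1 / 2), 1 / 2]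
  have h : ∀ k, halfPeriod τ k = α k * (periods τ).ω₁ + β k * (periods τ).ω₂ := by
    intro k
    fin_cases k <;> simp [halfPeriod, α, β, periods] <;> ring
  have hs : halfPeriod τ i - halfPeriod τ j =
      ((α i - α j : ℚ) : ℂ) * (periods τ).ω₁ + ((β i - β j : ℚ) : ℂ) * (periods τ).ω₂ := by
    rw [h i, h j]
    push_cast
    ring
  rw [hs, PeriodPair.mul_ω₁_add_mul_ω₂_mem_lattice]
  fin_cases i <;> fin_cases j <;> first | exact absurd rfl hij | (simp [α, β]; try norm_num)

theorem countable_lattice : ((periods τ).lattice : Set ℂ).Countable := by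
  have : Countable (periods τ).lattice := (periods τ).latticeEquivProd.toEquiv.countable_iff.2
    inferInstance
  exact Set.to_countable _

theorem poles_eq : poles τ l =
    ⋃ i, {x : ℂ | l i ≠ 0 ∧ x + halfPeriod τ i ∈ (periods τ).lattice} := by
  ext x
  simp [poles]

theorem isClosed_poles : IsClosed (poles τ l) := by
  rw [poles_eq]
  refine isClosed_iUnion_of_finite fun i => ?_
  by_cases hi : l i = 0
  · simp [hi]
  · simp only [ne_eq, hi, not_false_eq_true, true_and]
    exact (periods τ).isClosed_lattice.preimage (f := fun x => x + halfPeriod τ i) (by fun_prop)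

theorem countable_poles : (poles τ l).Countable := by
  rw [poles_eq]
  refine countable_iUnion fun i => ?_
  refine ((countable_lattice τ).preimage (f := fun x => x + halfPeriod τ i)
    (add_left_injective _)).mono fun x hx => hx.2

theorem isPreconnected_compl_poles : IsPreconnected (poles τ l)ᶜ :=
  ((countable_poles τ l).isConnected_compl_of_one_lt_rank (by simp)).isPreconnected

theorem eventually_notMem_lattice (x c : ℂ) : ∀ᶠ y in 𝓝[≠] x, y + c ∉ (periods τ).lattice := by
  have h := (periods τ).compl_lattice_sdiff_singleton_mem_nhds (x + c)
  have ht : Tendsto (fun y => y + c) (𝓝 x) (𝓝 (x + c)) := by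
    have : Continuous fun y : ℂ => y + c := by fun_prop
    exact this.tendsto x
  filter_upwards [nhdsWithin_le_nhds (ht h), self_mem_nhdsWithin] with y hy hyx hmem
  exact hy ⟨hmem, fun h => hyx (add_right_cancel h)⟩

theorem eventually_notMem_poles (x : ℂ) : ∀ᶠ y in 𝓝[≠] x, y ∈ (poles τ l)ᶜ := by
  have : ∀ᶠ y in 𝓝[≠] x, ∀ i, y + halfPeriod τ i ∉ (periods τ).lattice :=
    eventually_all.2 fun i => eventually_notMem_lattice τ x _
  filter_upwards [this] with y hy
  rintro ⟨i, -, hi⟩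
  exact hy i hi

theorem add_mem_compl_poles {P x : ℂ} (hP : P ∈ (periods τ).lattice) (hx : x ∈ (poles τ l)ᶜ) :
    x + P ∈ (poles τ l)ᶜ := by
  rintro ⟨i, hl, hi⟩
  refine hx ⟨i, hl, ?_⟩
  have := (periods τ).lattice.sub_mem hi hP
  rwa [add_right_comm, add_sub_cancel_right] at this

/-- The line through `τ / 4` in the direction of the real axis contains no pole. -/
theorem segmentAvoids_one : SegmentAvoids τ l 1 ((τ : ℂ) / 4) := by
  rintro t - ⟨i, -, hi⟩
  obtain ⟨n, hn⟩ := lattice_im hi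
  have hτ : τ.im ≠ 0 := τ.im_pos.ne'
  -- Each shift leaves an odd multiple of `Im τ / 4` as imaginary part, whereas lattice points have
  -- integer multiples of `Im τ`.
  have key : ∃ q : ℤ, 4 * n = q ∧ (q = 1 ∨ q = -1 ∨ q = 3) := by
    have h4 : ((τ : ℂ) / 4 + t * 1 + halfPeriod τ i).im =
        (![1 / 4, 1 / 4, -(1 / 4), 3 / 4] i : ℝ) * τ.im := by
      fin_cases i <;> simp [halfPeriod] <;> ring
    rw [h4] at hn
    have hn' := mul_right_cancel₀ hτ hn
    refine ⟨_, rfl, ?_⟩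
    fin_cases i <;> simp at hn'
    · left; have : (4 * n : ℝ) = 1 := by linarith
      exact_mod_cast this
    · left; have : (4 * n : ℝ) = 1 := by linarith
      exact_mod_cast this
    · right; left; have : (4 * n : ℝ) = -1 := by linarith
      exact_mod_cast this
    · right; right; have : (4 * n : ℝ) = 3 := by linarith
      exact_mod_cast this
  obtain ⟨q, h1, h2⟩ := key
  omega

end Poles

/-! ### Powers of the translates of `℘` and their linear independence -/

section BasisFunctions

variable {τ : UpperHalfPlane} {l : Fin 4 → ℕ}

/-- The functions `℘(x + ωᵢ) ^ (lᵢ - j)` of which `Ξ` is composed. -/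
def basisFun (τ : UpperHalfPlane) (l : Fin 4 → ℕ) (k : (i : Fin 4) × Fin (l i)) (x : ℂ) : ℂ :=
  wp τ (x + halfPeriod τ k.1) ^ (l k.1 - (k.2 : ℕ))

theorem analyticAt_wp {x : ℂ} (hx : x ∉ (periods τ).lattice) : AnalyticAt ℂ (wp τ) x :=
  (periods τ).analyticOnNhd_weierstrassP x hx

theorem analyticAt_wp_add {x c : ℂ} (hx : x + c ∉ (periods τ).lattice) :
    AnalyticAt ℂ (fun x => wp τ (x + c)) x :=
  (analyticAt_wp hx).comp (f := fun x => x + c) (by fun_prop)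

theorem analyticAt_basisFun_of_notMem {k : (i : Fin 4) × Fin (l i)} {x : ℂ}
    (hx : x + halfPeriod τ k.1 ∉ (periods τ).lattice) : AnalyticAt ℂ (basisFun τ l k) x :=
  (analyticAt_wp_add hx).pow _

theorem notMem_lattice_of_notMem_poles {i : Fin 4} (hi : l i ≠ 0) {x : ℂ} (hx : x ∈ (poles τ l)ᶜ) :
    x + halfPeriod τ i ∉ (periods τ).lattice := fun h => hx ⟨i, hi, h⟩

theorem analyticAt_basisFun (k : (i : Fin 4) × Fin (l i)) {x : ℂ} (hx : x ∈ (poles τ l)ᶜ) :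
    AnalyticAt ℂ (basisFun τ l k) x :=
  analyticAt_basisFun_of_notMem (notMem_lattice_of_notMem_poles
    (Nat.ne_of_gt (Fin.pos k.2)) hx)

theorem wp_add_of_mem {P : ℂ} (hP : P ∈ (periods τ).lattice) (x : ℂ) : wp τ (x + P) = wp τ x :=
  (periods τ).weierstrassP_add_coe x ⟨P, hP⟩

theorem basisFun_add_of_mem {P : ℂ} (hP : P ∈ (periods τ).lattice) (k : (i : Fin 4) × Fin (l i))
    (x : ℂ) : basisFun τ l k (x + P) = basisFun τ l k x := by
  rw [basisFun, add_right_comm, wp_add_of_mem hP, basisFun]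

theorem tendsto_wp_cobounded (c : ℂ) :
    Tendsto (fun x => wp τ (x + c)) (𝓝[≠] (-c)) (Bornology.cobounded ℂ) := by
  have h0 : Tendsto (wp τ) (𝓝[≠] 0) (Bornology.cobounded ℂ) := by
    refine tendsto_cobounded_of_meromorphicOrderAt_neg ?_
    have := (periods τ).order_weierstrassP 0 (zero_mem _)
    rw [show wp τ = (periods τ).weierstrassP from rfl, this]
    decide
  refine h0.comp (tendsto_nhdsWithin_of_tendsto_nhds_of_eventually_within _ ?_ ?_)
  · have : Continuous fun y : ℂ => y + c := by fun_prop
    simpa using (this.tendsto (-c)).mono_left (nhdsWithin_le_nhds (s := {-c}ᶜ))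
  · filter_upwards [self_mem_nhdsWithin] with x hx h
    exact hx (eq_neg_of_add_eq_zero_left h)

/-- The functions `℘(x + ωᵢ) ^ (lᵢ - j)` and the constant `1` are linearly independent. -/
theorem eq_zero_of_sum_basisFun_eq {a : (i : Fin 4) × Fin (l i) → ℂ} {c : ℂ}
    (h : ∀ x ∈ (poles τ l)ᶜ, ∑ k, a k * basisFun τ l k x = c) (k : (i : Fin 4) × Fin (l i)) :
    a k = 0 := by
  obtain ⟨i, j⟩ := k
  set p : ℂ[X] := ∑ j : Fin (l i), C (a ⟨i, j⟩) * X ^ (l i - (j : ℕ)) with hp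
  set R : ℂ → ℂ := fun x => c - ∑ i' ∈ Finset.univ.erase i, ∑ j : Fin (l i'),
    a ⟨i', j⟩ * basisFun τ l ⟨i', j⟩ x with hR
  -- The terms belonging to `ωᵢ` are isolated; all the others are regular at `-ωᵢ`, since distinct
  -- half-periods are incongruent.
  have hpR : ∀ᶠ x in 𝓝[≠] (-halfPeriod τ i), p.eval (wp τ (x + halfPeriod τ i)) = R x := by
    filter_upwards [eventually_notMem_poles τ l _] with x hx
    have h1 := h x hx
    rw [Fintype.sum_sigma, ← Finset.add_sum_erase _ _ (Finset.mem_univ i)] at h1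
    rw [hR, ← h1, hp, eval_finsetSum]
    simp [basisFun]
  have hRc : ContinuousAt R (-halfPeriod τ i) := by
    refine continuousAt_const.sub (tendsto_finsetSum _ fun i' hi' => tendsto_finsetSum _ fun j _ => ?_)
    refine (continuousAt_const.mul (analyticAt_basisFun_of_notMem ?_).continuousAt).tendsto
    rw [neg_add_eq_sub]
    exact halfPeriod_sub_notMem_lattice τ (Finset.ne_of_mem_erase hi')
  -- A nonconstant polynomial in `℘` would blow up at `-ωᵢ`, where `R` is continuous.
  have hdeg : ¬0 < p.degree := fun hd => by
    have h1 := p.tendsto_norm_atTop hd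
      (tendsto_norm_atTop_iff_cobounded.2 (tendsto_wp_cobounded (τ := τ) (halfPeriod τ i)))
    refine not_tendsto_atTop_of_tendsto_nhds
      (hRc.norm.tendsto.mono_left (nhdsWithin_le_nhds (s := {-halfPeriod τ i}ᶜ))) (h1.congr' ?_)
    filter_upwards [hpR] with x hx
    rw [hx]
  have hj : 0 < l i - (j : ℕ) := Nat.sub_pos_of_lt j.2
  have hz : p.coeff (l i - (j : ℕ)) = 0 := coeff_eq_zero_of_degree_lt
    ((not_lt.1 hdeg).trans_lt (by exact_mod_cast hj))
  rw [hp, finsetSum_coeff, Finset.sum_eq_single j] at hz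
  · simpa using hz
  · intro j' _ hj'
    rw [coeff_C_mul_X_pow, if_neg]
    intro he
    have := j.2
    have := j'.2
    exact hj' (Fin.ext (by omega))
  · simp

end BasisFunctions

end Inozemtsev

end

noncomputable section

namespace Inozemtsev

open Set

/-! ### `Ξ` as a polynomial in `E`, and the spectral polynomial -/

section Family

variable {τ : UpperHalfPlane} {l : Fin 4 → ℕ} {c₀ : ℂ[X]} {b : (i : Fin 4) → Fin (l i) → ℂ[X]}

/-- The `n`-th derivative in `x` of `Ξ(x,E)` as a polynomial in `E`. -/
def XiPoly (τ : UpperHalfPlane) (l : Fin 4 → ℕ) (c₀ : ℂ[X]) (b : (i : Fin 4) → Fin (l i) → ℂ[X])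
    (n : ℕ) (x : ℂ) : ℂ[X] :=
  (if n = 0 then c₀ else 0) + ∑ k : (i : Fin 4) × Fin (l i),
    C (iteratedDeriv n (basisFun τ l k) x) * b k.1 k.2

theorem eval_XiPoly (n : ℕ) (x E : ℂ) : (XiPoly τ l c₀ b n x).eval E =
    (if n = 0 then c₀.eval E else 0) + ∑ k : (i : Fin 4) × Fin (l i),
      iteratedDeriv n (basisFun τ l k) x * (b k.1 k.2).eval E := by
  rw [XiPoly, eval_add, eval_finsetSum]
  split_ifs <;> simp

theorem Xi_eq_sum (x E : ℂ) : Xi τ l c₀ b x E =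
    c₀.eval E + ∑ k : (i : Fin 4) × Fin (l i), (b k.1 k.2).eval E * basisFun τ l k x := by
  rw [Xi, Fintype.sum_sigma]
  rfl

theorem eval_XiPoly_zero (x E : ℂ) : (XiPoly τ l c₀ b 0 x).eval E = Xi τ l c₀ b x E := by
  rw [eval_XiPoly, Xi_eq_sum]
  simp [mul_comm]

theorem hasDerivAt_XiPoly (n : ℕ) (E : ℂ) {x : ℂ} (hx : x ∈ (poles τ l)ᶜ) :
    HasDerivAt (fun x => (XiPoly τ l c₀ b n x).eval E) ((XiPoly τ l c₀ b (n + 1) x).eval E) x := by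
  simp only [eval_XiPoly, Nat.add_eq_zero_iff, one_ne_zero, and_false, if_false, zero_add]
  refine (HasDerivAt.fun_sum fun k _ => ?_).const_add _
  rw [iteratedDeriv_succ]
  have : AnalyticAt ℂ (iteratedDeriv n (basisFun τ l k)) x := by
    rw [iteratedDeriv_eq_iterate]
    exact (analyticAt_basisFun k hx).iterated_deriv n
  exact this.differentiableAt.hasDerivAt.mul_const _

theorem iteratedDeriv_Xi (n : ℕ) (E : ℂ) {x : ℂ} (hx : x ∈ (poles τ l)ᶜ) :
    iteratedDeriv n (fun y => Xi τ l c₀ b y E) x = (XiPoly τ l c₀ b n x).eval E := by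
  induction n generalizing x with
  | zero => rw [iteratedDeriv_zero, eval_XiPoly_zero]
  | succ n ih =>
    rw [iteratedDeriv_succ, ← (hasDerivAt_XiPoly n E hx).deriv]
    refine EventuallyEq.deriv_eq ?_
    filter_upwards [(isClosed_poles τ l).isOpen_compl.mem_nhds hx] with y hy using ih hy

theorem hasDerivAt_potential {x : ℂ} (hx : x ∈ (poles τ l)ᶜ) :
    HasDerivAt (potential τ l) (potential' τ l x) x := by
  refine HasDerivAt.fun_sum fun i _ => ?_
  by_cases hi : l i = 0
  · simpa [hi] using hasDerivAt_const x (0 : ℂ)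
  · have h := analyticAt_wp (notMem_lattice_of_notMem_poles hi hx)
    have hd : HasDerivAt (wp τ) (wp' τ (x + halfPeriod τ i)) (x + halfPeriod τ i) := by
      have := h.differentiableAt.hasDerivAt
      rwa [show deriv (wp τ) = wp' τ from (periods τ).deriv_weierstrassP] at this
    exact (hd.comp_add_const x _).const_mul _

theorem potential_add_of_mem {P : ℂ} (hP : P ∈ (periods τ).lattice) (x : ℂ) :
    potential τ l (x + P) = potential τ l x := by
  simp only [potential]
  refine Finset.sum_congr rfl fun i _ => ?_
  rw [add_right_comm, wp_add_of_mem hP]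

theorem XiPoly_add_of_mem {P : ℂ} (hP : P ∈ (periods τ).lattice) (n : ℕ) (x : ℂ) :
    XiPoly τ l c₀ b n (x + P) = XiPoly τ l c₀ b n x := by
  simp only [XiPoly]
  congr 1
  refine Finset.sum_congr rfl fun k _ => ?_
  have := congrFun (iteratedDeriv_comp_add_const (n := n) (f := basisFun τ l k) (s := P)) x
  simp only [basisFun_add_of_mem hP] at this
  rw [← this]

namespace IsXiCoeff

variable (h : IsXiCoeff τ l c₀ b)
include h

/-- Validity for all `E` makes the equation an identity in `ℂ[X]`, whose coefficients can be
compared. -/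
theorem XiPoly_ode {x : ℂ} (hx : x ∈ (poles τ l)ᶜ) : XiPoly τ l c₀ b 3 x =
    4 * (C (potential τ l x) - X) * XiPoly τ l c₀ b 1 x +
      2 * C (potential' τ l x) * XiPoly τ l c₀ b 0 x := by
  refine Polynomial.funext fun E => ?_
  have h3 := h.ode E x hx
  have h1 := iteratedDeriv_Xi (c₀ := c₀) (b := b) 1 E hx
  rw [iteratedDeriv_one] at h1
  rw [iteratedDeriv_Xi 3 E hx, h1, ← eval_XiPoly_zero] at h3
  simp only [eval_add, eval_mul, eval_sub, eval_C, eval_X, eval_ofNat]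
  linear_combination h3

/-- Descending induction on the power of `E`. If all coefficients above `m ≥ deg c₀` vanish, the
coefficient of `E ^ (m + 1)` in the third order equation reduces to `-4` times that of `E ^ m` in
`Ξ'`. So the coefficient of `E ^ m` in the sum over the `b` is constant in `x`, and linear
independence kills each term. -/
theorem coeff_eq_zero {n : ℕ} (hn : c₀.natDegree ≤ n) (k : (i : Fin 4) × Fin (l i)) :
    (b k.1 k.2).coeff n = 0 := by
  obtain ⟨N, hN⟩ : ∃ N, ∀ k : (i : Fin 4) × Fin (l i), ∀ n ≥ N, (b k.1 k.2).coeff n = 0 :=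
    ⟨Finset.univ.sup (fun k : (i : Fin 4) × Fin (l i) => (b k.1 k.2).natDegree) + 1,
      fun k n hn => coeff_eq_zero_of_natDegree_lt (lt_of_le_of_lt
        (Finset.le_sup (f := fun k : (i : Fin 4) × Fin (l i) => (b k.1 k.2).natDegree)
          (Finset.mem_univ k)) hn)⟩
  have hstep : ∀ m, c₀.natDegree ≤ m →
      (∀ k : (i : Fin 4) × Fin (l i), ∀ n ≥ m + 1, (b k.1 k.2).coeff n = 0) →
      ∀ k : (i : Fin 4) × Fin (l i), (b k.1 k.2).coeff m = 0 := by
    intro m hm hb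
    have hcoeff : ∀ n x, (XiPoly τ l c₀ b n x).coeff (m + 1) = 0 := fun n x => by
      rw [XiPoly, coeff_add, finsetSum_coeff, Finset.sum_eq_zero fun k _ => ?_, add_zero]
      · split_ifs
        · exact coeff_eq_zero_of_natDegree_lt (by omega)
        · exact coeff_zero _
      · rw [coeff_C_mul, hb k _ le_rfl, mul_zero]
    have h1 : ∀ x ∈ (poles τ l)ᶜ, (XiPoly τ l c₀ b 1 x).coeff m = 0 := fun x hx => by
      have := congrArg (fun p => coeff p (m + 1)) (h.XiPoly_ode hx)
      have e : 4 * (C (potential τ l x) - X) * XiPoly τ l c₀ b 1 x +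
          2 * C (potential' τ l x) * XiPoly τ l c₀ b 0 x =
          C (4 * potential τ l x) * XiPoly τ l c₀ b 1 x - C 4 * (XiPoly τ l c₀ b 1 x * X) +
            C (2 * potential' τ l x) * XiPoly τ l c₀ b 0 x := by
        simp only [C_mul, map_ofNat]
        ring
      simp only [e, coeff_add, coeff_sub, coeff_C_mul, hcoeff, coeff_mul_X] at this
      simpa using this
    have hconst : ∀ x ∈ (poles τ l)ᶜ, HasDerivAt (fun x => ∑ k : (i : Fin 4) × Fin (l i),
        (b k.1 k.2).coeff m * basisFun τ l k x) 0 x := fun x hx => by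
      have := HasDerivAt.fun_sum (u := Finset.univ) fun (k : (i : Fin 4) × Fin (l i)) _ =>
        (analyticAt_basisFun k hx).differentiableAt.hasDerivAt.const_mul ((b k.1 k.2).coeff m)
      refine this.congr_deriv ?_
      rw [← h1 x hx, XiPoly, coeff_add, finsetSum_coeff]
      simp [iteratedDeriv_one, mul_comm]
    obtain ⟨c, hc⟩ := (isClosed_poles τ l).isOpen_compl.exists_is_const_of_deriv_eq_zero
      (isPreconnected_compl_poles τ l)
      (fun x hx => (hconst x hx).differentiableAt.differentiableWithinAt)
      (fun x hx => (hconst x hx).deriv)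
    exact eq_zero_of_sum_basisFun_eq (a := fun k => (b k.1 k.2).coeff m) hc
  have hall : ∀ d m, c₀.natDegree ≤ m → N ≤ m + d →
      ∀ k : (i : Fin 4) × Fin (l i), ∀ n ≥ m, (b k.1 k.2).coeff n = 0 := by
    intro d
    induction d with
    | zero => exact fun m _ hm k n hn => hN k n (by omega)
    | succ d ih =>
      intro m hm hmd k n hn
      have h1 := ih (m + 1) (by omega) (by omega)
      rcases hn.lt_or_eq with hlt | rfl
      · exact h1 k n hlt
      · exact hstep _ hm h1 k
  exact hall N n hn (by omega) k n le_rfl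

theorem degree_sum_lt (a : (i : Fin 4) × Fin (l i) → ℂ) :
    (∑ k, C (a k) * b k.1 k.2).degree < c₀.natDegree :=
  (degree_lt_iff_coeff_zero _ _).2 fun m hm => by
    rw [finsetSum_coeff]
    exact Finset.sum_eq_zero fun k _ => by rw [coeff_C_mul, h.coeff_eq_zero hm, mul_zero]

theorem degree_add_sum (a : (i : Fin 4) × Fin (l i) → ℂ) :
    (c₀ + ∑ k, C (a k) * b k.1 k.2).degree = c₀.natDegree := by
  have h0 := degree_eq_natDegree h.monic.ne_zero
  rw [degree_add_eq_left_of_degree_lt, h0]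
  rw [h0]
  exact h.degree_sum_lt a

/-- The first integral has zero derivative on the connected complement of the poles, so its value at
one point serves for all. There `Ξ² (E - u)` is monic of degree `2g + 1`, and the terms with
derivatives have degree at most `2g`. -/
theorem exists_spectralPolynomial : ∃ Q : ℂ[X], Q.Monic ∧ Q.natDegree = 2 * c₀.natDegree + 1 ∧
    ∀ E : ℂ, ∀ x ∈ (poles τ l)ᶜ, Q.eval E = (XiPoly τ l c₀ b 0 x).eval E ^ 2 * (E - potential τ l x)
      + 1 / 2 * (XiPoly τ l c₀ b 0 x).eval E * (XiPoly τ l c₀ b 2 x).eval E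
      - 1 / 4 * (XiPoly τ l c₀ b 1 x).eval E ^ 2 := by
  have hx₀ : (τ : ℂ) / 4 ∈ (poles τ l)ᶜ := by simpa using segmentAvoids_one τ l 0 (by simp)
  set x₀ : ℂ := (τ : ℂ) / 4
  set g := c₀.natDegree with hg
  have hmon : (XiPoly τ l c₀ b 0 x₀).Monic := by
    rw [XiPoly, if_pos rfl]
    exact h.monic.add_of_left (by
      rw [degree_eq_natDegree h.monic.ne_zero]
      exact h.degree_sum_lt _)
  have hdeg0 : (XiPoly τ l c₀ b 0 x₀).degree = g := by
    rw [XiPoly, if_pos rfl]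
    exact h.degree_add_sum _
  have hdeg : ∀ n, n ≠ 0 → (XiPoly τ l c₀ b n x₀).natDegree ≤ g := fun n hn => by
    rw [XiPoly, if_neg hn, zero_add]
    exact natDegree_le_of_degree_le (h.degree_sum_lt _).le
  have hnat0 : (XiPoly τ l c₀ b 0 x₀).natDegree = g := natDegree_eq_of_degree_eq_some hdeg0
  set M : ℂ[X] := XiPoly τ l c₀ b 0 x₀ ^ 2 * (X - C (potential τ l x₀)) with hM
  set L : ℂ[X] := C (1 / 2) * (XiPoly τ l c₀ b 0 x₀ * XiPoly τ l c₀ b 2 x₀)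
      - C (1 / 4) * XiPoly τ l c₀ b 1 x₀ ^ 2 with hL
  have hMm : M.Monic := (hmon.pow 2).mul (monic_X_sub_C _)
  have hMd : M.natDegree = 2 * g + 1 := by
    rw [hM, (hmon.pow 2).natDegree_mul (monic_X_sub_C _), hmon.natDegree_pow, hnat0,
      natDegree_X_sub_C]
  have hLd : L.natDegree ≤ 2 * g := by
    rw [hL, ← max_self (2 * g)]
    refine natDegree_sub_le_of_le ?_ ?_
    · refine (natDegree_C_mul_le _ _).trans ?_
      rw [two_mul]
      exact natDegree_mul_le_of_le hnat0.le (hdeg 2 two_ne_zero)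
    · refine (natDegree_C_mul_le _ _).trans ?_
      exact natDegree_pow_le_of_le 2 (hdeg 1 one_ne_zero)
  have hlt : L.degree < M.degree := by
    rw [degree_eq_natDegree hMm.ne_zero, hMd]
    exact (degree_le_of_natDegree_le hLd).trans_lt (by exact_mod_cast Nat.lt_succ_self _)
  refine ⟨M + L, hMm.add_of_left hlt, ?_, fun E x hx => ?_⟩
  · rw [natDegree_eq_of_degree_eq (degree_add_eq_left_of_degree_lt hlt), hMd]
  · have hd : ∀ x ∈ (poles τ l)ᶜ, HasDerivAt (fun x =>
        (XiPoly τ l c₀ b 0 x).eval E ^ 2 * (E - potential τ l x)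
        + 1 / 2 * (XiPoly τ l c₀ b 0 x).eval E * (XiPoly τ l c₀ b 2 x).eval E
        - 1 / 4 * (XiPoly τ l c₀ b 1 x).eval E ^ 2) 0 x := fun x hx => by
      have d0 := hasDerivAt_XiPoly (c₀ := c₀) (b := b) 0 E hx
      have d1 := hasDerivAt_XiPoly (c₀ := c₀) (b := b) 1 E hx
      have d2 := hasDerivAt_XiPoly (c₀ := c₀) (b := b) 2 E hx
      have du := hasDerivAt_potential (l := l) hx
      refine ((((d0.fun_pow 2).fun_mul (du.const_sub E)).fun_add
        ((d0.const_mul (1 / 2)).fun_mul d2)).fun_sub ((d1.fun_pow 2).const_mul (1 / 4))).congr_deriv ?_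
      have h3 := congrArg (eval E) (h.XiPoly_ode hx)
      simp only [eval_add, eval_mul, eval_sub, eval_C, eval_X, eval_ofNat] at h3
      simp only [zero_add, Nat.reduceAdd, h3]
      push_cast
      ring
    have := (isClosed_poles τ l).isOpen_compl.is_const_of_deriv_eq_zero
      (isPreconnected_compl_poles τ l)
      (fun x hx => (hd x hx).differentiableAt.differentiableWithinAt)
      (fun x hx => (hd x hx).deriv) hx₀ hx
    rw [← this, hM, hL]
    simp only [eval_add, eval_mul, eval_sub, eval_C, eval_X, eval_pow]
    ring

/-- If `Ξ(·,E)` vanished identically, linear independence would make `X - E` a common divisor of all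
the coefficients. -/
theorem not_eventually_eq_zero {E x : ℂ} (hx : x ∈ (poles τ l)ᶜ) :
    ¬∀ᶠ y in 𝓝 x, Xi τ l c₀ b y E = 0 := by
  intro hev
  have ha : AnalyticOnNhd ℂ (fun y => Xi τ l c₀ b y E) (poles τ l)ᶜ := fun y hy => by
    simp only [Xi_eq_sum]
    exact analyticAt_const.add
      (Finset.analyticAt_fun_sum _ fun k _ => analyticAt_const.mul (analyticAt_basisFun k hy))
  have hz := ha.eqOn_zero_of_preconnected_of_eventuallyEq_zero (isPreconnected_compl_poles τ l)
    hx hev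
  have hsum : ∀ y ∈ (poles τ l)ᶜ, ∑ k : (i : Fin 4) × Fin (l i),
      (b k.1 k.2).eval E * basisFun τ l k y = -c₀.eval E := fun y hy => by
    have h1 : Xi τ l c₀ b y E = 0 := hz hy
    rw [Xi_eq_sum] at h1
    linear_combination h1
  have hb := eq_zero_of_sum_basisFun_eq (a := fun k => (b k.1 k.2).eval E) hsum
  have hc : c₀.eval E = 0 := by
    have := hsum x hx
    simp only [hb, zero_mul, Finset.sum_const_zero] at this
    simpa using this.symm
  exact not_isUnit_X_sub_C E
    (h.coprime (X - C E) (dvd_iff_isRoot.2 hc) fun i j => dvd_iff_isRoot.2 (hb ⟨i, j⟩))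

theorem eventually_ne_zero (E : ℂ) {x : ℂ} (hx : x ∈ (poles τ l)ᶜ) :
    ∀ᶠ y in 𝓝[≠] x, Xi τ l c₀ b y E ≠ 0 := by
  have ha : AnalyticAt ℂ (fun y => Xi τ l c₀ b y E) x := by
    simp only [Xi_eq_sum]
    exact analyticAt_const.add
      (Finset.analyticAt_fun_sum _ fun k _ => analyticAt_const.mul (analyticAt_basisFun k hx))
  exact ha.eventually_eq_zero_or_eventually_ne_zero.resolve_left (h.not_eventually_eq_zero hx)

theorem isProductFamily {Q : ℂ[X]}
    (hQ : ∀ E : ℂ, ∀ x ∈ (poles τ l)ᶜ, Q.eval E =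
      (XiPoly τ l c₀ b 0 x).eval E ^ 2 * (E - potential τ l x)
      + 1 / 2 * (XiPoly τ l c₀ b 0 x).eval E * (XiPoly τ l c₀ b 2 x).eval E
      - 1 / 4 * (XiPoly τ l c₀ b 1 x).eval E ^ 2) :
    IsProductFamily (poles τ l)ᶜ (potential τ l) (potential' τ l)
      (fun x E => (XiPoly τ l c₀ b 0 x).eval E) (fun x E => (XiPoly τ l c₀ b 1 x).eval E)
      (fun x E => (XiPoly τ l c₀ b 2 x).eval E) (fun E => Q.eval E) where
  hasDerivAt_potential x hx := hasDerivAt_potential hx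
  hasDerivAt_zero E x hx := hasDerivAt_XiPoly 0 E hx
  hasDerivAt_one E x hx := hasDerivAt_XiPoly 1 E hx
  hasDerivAt_two E x hx := by
    refine (hasDerivAt_XiPoly 2 E hx).congr_deriv ?_
    rw [h.XiPoly_ode hx]
    simp only [eval_add, eval_mul, eval_sub, eval_C, eval_X, eval_ofNat]
  integral_eq := hQ
  differentiable_zero x _ := Polynomial.differentiable _
  differentiable_one x _ := Polynomial.differentiable _
  differentiable_two x _ := Polynomial.differentiable _

end IsXiCoeff

end Family

end Inozemtsev

end

noncomputable section

namespace Inozemtsev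

open Set intervalIntegral

/-! ### The integral over the period `1` -/

section RealPeriod

/-- The integral over a real period of a function with period `1`, holomorphic in a horizontal
strip, does not depend on the position of the segment in the strip. -/
theorem integral_eq_of_mem_strip {f : ℂ → ℂ} {a : ℝ}
    (hf : ∀ z : ℂ, 0 < z.im → z.im < a → DifferentiableAt ℂ f z) (hper : ∀ z, f (z + 1) = f z)
    {z w : ℂ} (hz : 0 < z.im ∧ z.im < a) (hw : 0 < w.im ∧ w.im < a) :
    ∫ t in (0 : ℝ)..1, f (z + t) = ∫ t in (0 : ℝ)..1, f (w + t) := by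
  have hline : ∀ z : ℂ, ∫ t in (0 : ℝ)..1, f (z + t) =
      ∫ t in (0 : ℝ)..1, f (t + z.im * Complex.I) := fun z => by
    have hp : Function.Periodic (fun t : ℝ => f (t + z.im * Complex.I)) 1 := fun t => by
      have := hper (t + z.im * Complex.I)
      simp only [Complex.ofReal_add, Complex.ofReal_one]
      rw [← this]
      congr 1
      ring
    have h1 := hp.intervalIntegral_add_eq z.re 0
    rw [zero_add] at h1
    rw [← h1]
    have h2 := integral_comp_add_left (a := 0) (b := 1)
      (fun t : ℝ => f (t + z.im * Complex.I)) z.re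
    rw [add_zero] at h2
    rw [← h2]
    refine integral_congr fun t _ => ?_
    simp only [Complex.ofReal_add]
    congr 1
    conv_lhs => rw [← Complex.re_add_im z]
    ring
  rw [hline z, hline w]
  -- The rectangle has width equal to the period, so its vertical sides cancel in Cauchy's theorem.
  have hrect := Complex.integral_boundary_rect_eq_zero_of_differentiableOn f
    (z.im * Complex.I) (1 + w.im * Complex.I) (fun x hx => by
      have hx2 : x.im ∈ uIcc z.im w.im := by simpa using hx.2
      have := (ordConnected_Ioo (a := (0 : ℝ)) (b := a)).uIcc_subset hz hw hx2
      exact (hf x this.1 this.2).differentiableWithinAt)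
  have hsides : ∀ y : ℝ, f (1 + y * Complex.I) = f (y * Complex.I) := fun y => by
    rw [add_comm, hper]
  simp [hsides] at hrect
  exact sub_eq_zero.1 hrect

variable {τ : UpperHalfPlane} {l : Fin 4 → ℕ} {c₀ : ℂ[X]} {b : (i : Fin 4) → Fin (l i) → ℂ[X]}

/-- The integral of `℘ ^ m` over the period `1`. -/
def wpPeriod (τ : UpperHalfPlane) (m : ℕ) : ℂ :=
  ∫ t in (0 : ℝ)..1, wp τ ((τ : ℂ) / 2 + t) ^ m

/-- The segment lies strictly between two horizontal rows of lattice points; translated into the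
strip `0 < Im < Im τ`, it gives the same integral as the reference segment at height `Im τ / 2`. -/
theorem integral_wp_pow {z : ℂ} (hz : ∀ t ∈ Icc (0 : ℝ) 1, z + t ∉ (periods τ).lattice) (m : ℕ) :
    ∫ t in (0 : ℝ)..1, wp τ (z + t) ^ m = wpPeriod τ m := by
  have hτ := τ.im_pos
  set n : ℤ := ⌊z.im / τ.im⌋ with hn
  have h1 : (n : ℝ) * τ.im ≤ z.im := (le_div_iff₀ hτ).1 (Int.floor_le _)
  have h2 : z.im < (n + 1) * τ.im := (div_lt_iff₀ hτ).1 (Int.lt_floor_add_one _)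
  -- A horizontal segment of length `1` on a row of lattice points would contain one of them.
  have h3 : (n : ℝ) * τ.im ≠ z.im := fun he => by
    have hr := Int.ceil_lt_add_one (z.re - n * τ.re)
    have hr' := Int.le_ceil (z.re - n * τ.re)
    refine hz (⌈z.re - n * τ.re⌉ - (z.re - n * τ.re)) ⟨by linarith, by linarith⟩ ?_
    convert intCast_add_mul_mem_lattice τ ⌈z.re - n * τ.re⌉ n using 1
    apply Complex.ext
    · simp
      ring
    · simp [← he]
  have hmem : ∀ w : ℂ, 0 < w.im → w.im < τ.im → w ∉ (periods τ).lattice := fun w hw0 hw1 hw => by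
    obtain ⟨k, hk⟩ := lattice_im hw
    rw [hk] at hw0 hw1
    have hk0 : (0 : ℝ) < k := pos_of_mul_pos_left hw0 hτ.le
    have hk1 : (k : ℝ) < 1 := by nlinarith
    have : (0 : ℤ) < k := by exact_mod_cast hk0
    have : k < (1 : ℤ) := by exact_mod_cast hk1
    omega
  have hper : ∀ k : ℤ, ∀ z, wp τ (z + k * τ) = wp τ z := fun k z => by
    have := wp_add_of_mem (intCast_add_mul_mem_lattice τ 0 k) z
    simpa using this
  have hper1 : ∀ z, wp τ (z + 1) = wp τ z := fun z => by
    have := wp_add_of_mem (intCast_add_mul_mem_lattice τ 1 0) z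
    simpa using this
  have hshift : ∫ t in (0 : ℝ)..1, wp τ (z + t) ^ m =
      ∫ t in (0 : ℝ)..1, wp τ ((z - n * τ) + t) ^ m := integral_congr fun t _ => by
    rw [← hper n (z - n * τ + t)]
    congr 2
    ring
  rw [hshift, wpPeriod]
  refine integral_eq_of_mem_strip (f := fun w => wp τ w ^ m) (a := τ.im)
    (fun w hw0 hw1 => ((analyticAt_wp (hmem w hw0 hw1)).pow m).differentiableAt)
    (fun w => by simp only [hper1]) ?_ ?_
  · have : (z - n * τ).im = z.im - n * τ.im := by simp
    rw [this]
    exact ⟨sub_pos.2 (lt_of_le_of_ne h1 h3), by linarith⟩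
  · have : ((τ : ℂ) / 2).im = τ.im / 2 := by simp
    rw [this]
    exact ⟨by linarith, by linarith⟩

/-- The integral of `Ξ(x,E)` over the period `1`, as a polynomial in `E`. -/
def periodPoly (τ : UpperHalfPlane) (l : Fin 4 → ℕ) (c₀ : ℂ[X])
    (b : (i : Fin 4) → Fin (l i) → ℂ[X]) : ℂ[X] :=
  c₀ + ∑ k : (i : Fin 4) × Fin (l i), C (wpPeriod τ (l k.1 - (k.2 : ℕ))) * b k.1 k.2

theorem eval_periodPoly {ε : ℂ} (hε : SegmentAvoids τ l 1 ε) (E : ℂ) :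
    (periodPoly τ l c₀ b).eval E = periodIntegral τ l c₀ b 1 ε E := by
  have hc : ∀ k : (i : Fin 4) × Fin (l i), IntervalIntegrable
      (fun t : ℝ => (b k.1 k.2).eval E * basisFun τ l k (ε + t * 1)) MeasureTheory.volume 0 1 :=
    fun k => by
      refine ContinuousOn.intervalIntegrable fun t ht => ?_
      rw [uIcc_of_le zero_le_one] at ht
      have h1 := (analyticAt_basisFun k (hε t ht)).continuousAt
      have h2 : ContinuousAt (fun t : ℝ => ε + (t : ℂ) * 1) t := by fun_prop
      exact (continuousAt_const.mul (h1.comp_of_eq h2 rfl)).continuousWithinAt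
  have hk : ∀ k : (i : Fin 4) × Fin (l i),
      ∫ t in (0 : ℝ)..1, (b k.1 k.2).eval E * basisFun τ l k (ε + t * 1) =
        wpPeriod τ (l k.1 - (k.2 : ℕ)) * (b k.1 k.2).eval E := fun k => by
    rw [intervalIntegral.integral_const_mul, mul_comm, ← integral_wp_pow (z := ε + halfPeriod τ k.1)]
    · congr 1
      refine integral_congr fun t _ => ?_
      simp only [basisFun, mul_one, add_right_comm]
    · intro t ht
      have := notMem_lattice_of_notMem_poles (Nat.ne_of_gt (Fin.pos k.2)) (hε t ht)
      rwa [mul_one, add_right_comm] at this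
  rw [periodIntegral, periodPoly]
  simp only [mul_one, Xi_eq_sum] at hk hc ⊢
  have hs : IntervalIntegrable (fun t : ℝ => ∑ k : (i : Fin 4) × Fin (l i),
      (b k.1 k.2).eval E * basisFun τ l k (ε + t)) MeasureTheory.volume 0 1 := by
    rw [← Finset.sum_fn]
    exact IntervalIntegrable.sum _ fun k _ => hc k
  rw [integral_add (by simp) hs, integral_finsetSum fun k _ => hc k]
  simp only [hk]
  simp [eval_finsetSum]

end RealPeriod

end Inozemtsev

end

noncomputable section

namespace Inozemtsev

/-! ### The multiplier of `Λ` along a period -/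

section Period

variable {τ : UpperHalfPlane} {l : Fin 4 → ℕ} {c₀ : ℂ[X]} {b : (i : Fin 4) → Fin (l i) → ℂ[X]}

theorem IsLambda.isSqrtMulExp {E s : ℂ} {Λ : ℂ → ℂ} (h : IsLambda τ l c₀ b E s Λ) :
    IsSqrtMulExp (poles τ l)ᶜ (fun x => (XiPoly τ l c₀ b 0 x).eval E) s Λ := by
  simp only [eval_XiPoly_zero]
  exact h.formula

/-- The period integral of `Ξ` is continuous in `E`. -/
theorem continuous_periodIntegral {P ε : ℂ} (hε : SegmentAvoids τ l P ε) :
    Continuous (periodIntegral τ l c₀ b P ε) := by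
  have hk : ∀ k : (i : Fin 4) × Fin (l i), IntervalIntegrable
      (fun t : ℝ => basisFun τ l k (ε + t * P)) MeasureTheory.volume 0 1 := fun k => by
    refine ContinuousOn.intervalIntegrable fun t ht => ?_
    rw [Set.uIcc_of_le zero_le_one] at ht
    have h1 := (analyticAt_basisFun k (hε t ht)).continuousAt
    have h2 : ContinuousAt (fun t : ℝ => ε + (t : ℂ) * P) t := by fun_prop
    exact (h1.comp_of_eq h2 rfl).continuousWithinAt
  have heq : periodIntegral τ l c₀ b P ε = fun E => (c₀.eval E + ∑ k : (i : Fin 4) × Fin (l i),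
      (b k.1 k.2).eval E * ∫ t in (0 : ℝ)..1, basisFun τ l k (ε + t * P)) * P := by
    funext E
    have hs : IntervalIntegrable (fun t : ℝ => ∑ k : (i : Fin 4) × Fin (l i),
        (b k.1 k.2).eval E * basisFun τ l k (ε + t * P)) MeasureTheory.volume 0 1 := by
      rw [← Finset.sum_fn]
      exact IntervalIntegrable.sum _ fun k _ => (hk k).const_mul _
    simp only [periodIntegral, Xi_eq_sum]
    rw [intervalIntegral.integral_mul_const, intervalIntegral.integral_add (by simp) hs,
      intervalIntegral.integral_finsetSum fun k _ => (hk k).const_mul _]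
    simp [intervalIntegral.integral_const_mul]
  rw [heq]
  exact (c₀.continuous.add (continuous_finsetSum _ fun k _ =>
    (b k.1 k.2).continuous.mul continuous_const)).mul continuous_const

namespace IsXiCoeff

theorem exists_ne_zero_of_isLambda (h : IsXiCoeff τ l c₀ b) {E s : ℂ} {Λ : ℂ → ℂ} (hΛ : IsLambda τ l c₀ b E s Λ) :
    ∃ x, Λ x ≠ 0 := by
  have hx₀ : (τ : ℂ) / 4 ∈ (poles τ l)ᶜ := by simpa using segmentAvoids_one τ l 0 (by simp)
  obtain ⟨x, hx1, hx2⟩ := ((h.eventually_ne_zero E hx₀).and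
    (eventually_notMem_poles τ l _)).exists
  exact ⟨x, hΛ.isSqrtMulExp.ne_zero hx2 (by rwa [eval_XiPoly_zero])⟩

variable (h : IsXiCoeff τ l c₀ b) {Q : ℂ[X]}
  (hQ : ∀ E : ℂ, ∀ x ∈ (poles τ l)ᶜ, Q.eval E =
      (XiPoly τ l c₀ b 0 x).eval E ^ 2 * (E - potential τ l x)
      + 1 / 2 * (XiPoly τ l c₀ b 0 x).eval E * (XiPoly τ l c₀ b 2 x).eval E
      - 1 / 4 * (XiPoly τ l c₀ b 1 x).eval E ^ 2)
include h hQ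

/-- The multiplier of `Λ` along a period is a regular function on the curve `ν² = -Q(E)`, with
logarithmic differential `-(∫ Ξ dx) dE / 2ν`. -/
theorem exists_isMonodromy {P ε : ℂ} (hP : P ∈ (periods τ).lattice)
    (hε : SegmentAvoids τ l P ε) :
    ∃ α β : ℂ → ℂ, IsMonodromy α β (periodIntegral τ l c₀ b P ε) (fun E => Q.eval E) ∧
      ∀ E s Λ, s ^ 2 = -Q.eval E → IsLambda τ l c₀ b E s Λ →
        ∀ x, Λ (x + P) = (α E + β E * s) * Λ x := by
  have hF := h.isProductFamily hQ
  have hUo := (isClosed_poles τ l).isOpen_compl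
  have hεU : ε ∈ (poles τ l)ᶜ := by simpa using hε 0 (by simp)
  obtain ⟨α, β, hαβ⟩ := hF.exists_monodromy (ε := ε) (P := P) hε (potential_add_of_mem hP ε)
    (by simp only [XiPoly_add_of_mem hP]) (by simp only [XiPoly_add_of_mem hP])
    -- `B(ε)` is nonzero for every `E`: vanishing of `Ξ`, `Ξ'` and `Ξ''` at `ε` would force `Ξ(·,E)`
    -- to vanish near `ε`.
    (by simp only [XiPoly_add_of_mem hP]) (fun E hE => by
      have := hF.eventually_eq_zero hUo hεU hE.1 hE.2.1 hE.2.2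
      simp only [eval_XiPoly_zero] at this
      exact h.not_eventually_eq_zero hεU this)
  simp only [eval_XiPoly_zero] at hαβ
  have hM : IsMonodromy α β (periodIntegral τ l c₀ b P ε) (fun E => Q.eval E) :=
    ⟨fun E => (hαβ E).1, fun E => (hαβ E).2.1, fun E => (hαβ E).2.2.1⟩
  refine ⟨α, β, hM, fun E s Λ hs hΛ x => ?_⟩
  have hne : ∀ x ∈ (poles τ l)ᶜ, ∀ᶠ y in 𝓝[≠] x, (XiPoly τ l c₀ b 0 y).eval E ≠ 0 := fun x hx => by
    simp only [eval_XiPoly_zero]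
    exact h.eventually_ne_zero E hx
  have hf := hΛ.isSqrtMulExp
  have hrel := hF.eigenfunction_relation hUo hne hs hΛ.meromorphic hf hεU
  simp only [eval_XiPoly_zero] at hrel
  have hrel' := hF.eigenfunction_relation_deriv hUo hne hs hΛ.meromorphic hf hεU
  simp only [eval_XiPoly_zero] at hrel'
  obtain ⟨h1, h2⟩ := (hαβ E).2.2.2 Λ (deriv Λ)
    (fun x hx => (hF.analyticAt_eigenfunction hUo hne hs hΛ.meromorphic hf
      hx).differentiableAt.hasDerivAt)
    (fun x hx => hF.deriv_deriv_eigenfunction hUo hne hs hΛ.meromorphic hf hx) s hrel hrel'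
  exact hF.add_period_eq hUo hne hs hΛ.meromorphic hf (isPreconnected_compl_poles τ l)
    (eventually_notMem_poles τ l) (fun x hx => add_mem_compl_poles τ l hP hx)
    (fun x _ => potential_add_of_mem hP x) hεU (hM.multiplier_ne_zero hs) h1 h2 x

/-- Because `Λ₀` is not identically zero, its multiplier at the start of the path must be `σ`; the
multiplier at the end follows by integrating the logarithmic differential. -/
theorem exists_hasPathIntegral {P ε : ℂ} (hP : P ∈ (periods τ).lattice)
    (hε : SegmentAvoids τ l P ε) {E₀ s₀ E₁ s₁ : ℂ} {γ s : ℝ → ℂ}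
    (hγ : IsBranchPath Q E₀ s₀ E₁ s₁ γ s) {Λ₀ Λ₁ : ℂ → ℂ} (h₀ : IsLambda τ l c₀ b E₀ s₀ Λ₀)
    (h₁ : IsLambda τ l c₀ b E₁ s₁ Λ₁) {σ : ℂ} (hσ : ∀ x, Λ₀ (x + P) = σ * Λ₀ x) :
    ∃ J : ℂ, HasPathIntegral (periodIntegral τ l c₀ b P ε) γ s J ∧
      ∀ x, Λ₁ (x + P) = σ * Λ₁ x * Complex.exp (-(1 / 2) * J) := by
  obtain ⟨α, β, hM, hΛ⟩ := h.exists_isMonodromy hQ hP hε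
  obtain ⟨J, hJ, hmul⟩ := hM.exists_hasPathIntegral (continuous_periodIntegral hε) hγ
  have hs₀ : s₀ ^ 2 = -Q.eval E₀ := by
    have := hγ.sq_root 0 (by simp)
    rwa [hγ.source.1, hγ.source.2] at this
  have hs₁ : s₁ ^ 2 = -Q.eval E₁ := by
    have := hγ.sq_root 1 (by simp)
    rwa [hγ.target.1, hγ.target.2] at this
  obtain ⟨x₀, hx₀⟩ := h.exists_ne_zero_of_isLambda h₀
  have hσ' : α E₀ + β E₀ * s₀ = σ :=
    mul_right_cancel₀ hx₀ ((hΛ _ _ _ hs₀ h₀ x₀).symm.trans (hσ x₀))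
  refine ⟨J, hJ, fun x => ?_⟩
  rw [hΛ _ _ _ hs₁ h₁ x, hmul, hσ']
  ring

end IsXiCoeff

end Period

end Inozemtsev

end

theorem theorem3p3 (τ : UpperHalfPlane) (l : Fin 4 → ℕ) (hl : l ≠ 0)
    (c₀ : ℂ[X]) (b : (i : Fin 4) → Fin (l i) → ℂ[X])
    (hΞ : Inozemtsev.IsXiCoeff τ l c₀ b) :
    ∃ Q Q₁ : ℂ[X],
      -- the polynomial `Q`
      (Q.Monic ∧ Q.natDegree = 2 * c₀.natDegree + 1 ∧
        ∀ E : ℂ, ∀ x ∉ Inozemtsev.poles τ l,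
          Q.eval E = Inozemtsev.firstIntegral τ l c₀ b x E) ∧
      -- the monodromy along an arbitrary period `P`
      (∀ P ∈ (Inozemtsev.periods τ).lattice, ∀ ε : ℂ, Inozemtsev.SegmentAvoids τ l P ε →
        ∀ (E₀ s₀ E₁ s₁ : ℂ) (γ s : ℝ → ℂ), Inozemtsev.IsBranchPath Q E₀ s₀ E₁ s₁ γ s →
        ∀ Λ₀ Λ₁ : ℂ → ℂ, Inozemtsev.IsLambda τ l c₀ b E₀ s₀ Λ₀ →
          Inozemtsev.IsLambda τ l c₀ b E₁ s₁ Λ₁ →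
        ∀ σ : ℂ, (σ = 1 ∨ σ = -1) → (∀ x, Λ₀ (x + P) = σ * Λ₀ x) →
        ∃ J : ℂ,
          Inozemtsev.HasPathIntegral (Inozemtsev.periodIntegral τ l c₀ b P ε) γ s J ∧
          ∀ x, Λ₁ (x + P) = σ * Λ₁ x * Complex.exp (-(1 / 2) * J)) ∧
      -- the polynomial `Q₁`
      (Q₁.degree = (c₀.natDegree : WithBot ℕ) ∧
        (∀ ε : ℂ, Inozemtsev.SegmentAvoids τ l 1 ε →
          ∀ E : ℂ, Q₁.eval E = Inozemtsev.periodIntegral τ l c₀ b 1 ε E) ∧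
        Inozemtsev.IsSecondKind Q Q₁) ∧
      -- the monodromy along the period `1`
      (∀ (E₀ s₀ E₁ s₁ : ℂ) (γ s : ℝ → ℂ), Inozemtsev.IsBranchPath Q E₀ s₀ E₁ s₁ γ s →
        ∀ Λ₀ Λ₁ : ℂ → ℂ, Inozemtsev.IsLambda τ l c₀ b E₀ s₀ Λ₀ →
          Inozemtsev.IsLambda τ l c₀ b E₁ s₁ Λ₁ →
        ∀ σ : ℂ, (σ = 1 ∨ σ = -1) → (∀ x, Λ₀ (x + 1) = σ * Λ₀ x) →
        ∃ J : ℂ,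
          Inozemtsev.HasPathIntegral (fun E => Q₁.eval E) γ s J ∧
          ∀ x, Λ₁ (x + 1) = σ * Λ₁ x * Complex.exp (-(1 / 2) * J)) := by
  obtain ⟨Q, hQm, hQd, hQ⟩ := hΞ.exists_spectralPolynomial
  have h1mem : (1 : ℂ) ∈ (Inozemtsev.periods τ).lattice :=
    (Inozemtsev.periods τ).ω₁_mem_lattice
  have hseg := Inozemtsev.segmentAvoids_one τ l
  have hfun : Inozemtsev.periodIntegral τ l c₀ b 1 ((τ : ℂ) / 4) =
      fun E => (Inozemtsev.periodPoly τ l c₀ b).eval E :=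
    funext fun E => (Inozemtsev.eval_periodPoly hseg E).symm
  have hdeg : (Inozemtsev.periodPoly τ l c₀ b).degree = (c₀.natDegree : WithBot ℕ) :=
    hΞ.degree_add_sum _
  refine ⟨Q, Inozemtsev.periodPoly τ l c₀ b, ⟨hQm, hQd, fun E x hx => ?_⟩, ?_,
    ⟨hdeg, fun ε hε E => Inozemtsev.eval_periodPoly hε E, ?_⟩, ?_⟩
  · have h1 := Inozemtsev.iteratedDeriv_Xi (c₀ := c₀) (b := b) 1 E hx
    rw [iteratedDeriv_one] at h1
    rw [hQ E x hx, Inozemtsev.firstIntegral, h1, Inozemtsev.iteratedDeriv_Xi 2 E hx,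
      Inozemtsev.eval_XiPoly_zero]
  · intro P hP ε hε E₀ s₀ E₁ s₁ γ s hγ Λ₀ Λ₁ h₀ h₁ σ _ hσ
    exact hΞ.exists_hasPathIntegral hQ hP hε hγ h₀ h₁ hσ
  · obtain ⟨α, β, hM, -⟩ := hΞ.exists_isMonodromy hQ h1mem hseg
    rw [hfun] at hM
    exact Inozemtsev.isSecondKind_of_isMonodromy hQm hQd (natDegree_eq_of_degree_eq_some hdeg) hM
  · intro E₀ s₀ E₁ s₁ γ s hγ Λ₀ Λ₁ h₀ h₁ σ _ hσ
    -- The integral over the period `1` is independent of the base point, so the general statement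
    -- is used at `ε = τ / 4`.
    rw [← hfun]
    exact hΞ.exists_hasPathIntegral hQ h1mem hseg hγ h₀ h₁ hσ
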